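/- Let $K=\mathbb F_q$ be a finite field of characteristic $p$ and let $\mathfrak g$ be a Lie subalgebra of the Lie algebra $\mathfrak{ut}(N,K)$ of strictly upper triangular $N\times N$ matrices. Assume that $p$ is large enough for the exponential map on $\mathfrak g$, in the sense that every product of $p$ elements of $\mathfrak g$ is zero (for instance, $p\ge N$), and put $\exp(x)=\sum_{k<p}x^k/k!$ for $x\in\mathfrak g$. Let $G$ be the subgroup of $\mathrm{GL}(N,K)$ generated by $\exp(\mathfrak g)$; it acts on $\mathfrak g$ by $\mathrm{Ad}_g(x)=gxg^{-1}$ and on the dual space $\mathfrak g^*$ by $\mathrm{Ad}^*_g\lambda(x)=\lambda(\mathrm{Ad}_g^{-1}x)$. For $\lambda\in\mathfrak g^*$ let $\Omega(\lambda)=\mathrm{Ad}^*_G\lambda$ be its coadjoint orbit, let $\mathfrak g^\lambda=\{x\in\mathfrak g:\lambda([x,y])=0\text{ for all }y\in\mathfrak g\}$, and put $\dim\Omega(\lambda)=\dim\mathfrak g-\dim\mathfrak g^\lambda$. A polarization of $\lambda$ is a Lie subalgebra $\mathfrak p\subseteq\mathfrak g$ that is maximal among the subspaces of $\mathfrak g$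 isotropic for the form $B_\lambda(x,y)=\lambda([x,y])$; let $P\le G$ be the subgroup generated by $\exp(\mathfrak p)$. Fix a nontrivial additive character $\psi:K\to\mathbb C^*$. Then these objects are well defined: $\exp:\mathfrak g\to G$ is a bijection, every $\lambda\in\mathfrak g^*$ has a polarization, and for every polarization $\mathfrak p$ of $\lambda$ one has $P=\exp(\mathfrak p)$ and there is exactly one homomorphism $\xi_\lambda:P\to\mathbb C^*$ with $\xi_\lambda(\exp x)=\psi(\lambda(x))$ for all $x\in\mathfrak p$. Let $T^\lambda=\mathrm{ind}(\xi_\lambda,P,G)$ be the induced complex representation. Then: 1. $\dim T^\lambda=q^{\frac12\dim\Omega(\lambda)}=\sqrt{|\Omega(\lambda)|}$. 2. Up to equivalence, $T^\lambda$ does not depend on the choice of the polarization $\mathfrak p$ of $\lambda$. 3. $T^\lambda$ is irreducible. 4. For $\lambda,\lambda'\in\mathfrak g^*$, and any choice of their polarizations, $T^\lambda$ and $T^{\lambda'}$ are equivalent if and only if $\lambda$ and $\lambda'$ lie in the same coadjoint orbit. 5. For every irreducible complex representation $T$ of $G$ there is $\lambda\in\mathfrak g^*$ such that $T$ is equivalent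 to $T^\lambda$. -/

import Mathlib

open scoped Nat

attribute [local instance] LieRing.ofAssociativeRing

noncomputable section

namespace OrbitMethod

/-! ### Lie-algebraic notions: isotropic subspaces, polarizations, stabilizers -/

section Lie

variable {K L : Type*} [Field K] [LieRing L] [LieAlgebra K L]

/-- The skew-symmetric bilinear form `B_lam(x, y) = lam([x, y])`. -/
def kirillovForm (lam : Module.Dual K L) : L →ₗ[K] L →ₗ[K] K :=
  LinearMap.mk₂ K (fun x y => lam ⁅x, y⁆)
    (by intros; simp) (by intros; simp) (by intros; simp) (by intros; simp)

/-- A subspace `W` is isotropic for `B_lam` if `B_lam(x, y) = 0` for all `x, y ∈ W`. -/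
def IsIsotropic (lam : Module.Dual K L) (W : Submodule K L) : Prop :=
  ∀ x ∈ W, ∀ y ∈ W, kirillovForm lam x y = 0

/-- A polarization of `lam` is a Lie subalgebra which is, as a subspace, maximal among the
isotropic subspaces of `B_lam`. -/
def IsPolarization (lam : Module.Dual K L) (𝔭 : LieSubalgebra K L) : Prop :=
  Maximal (IsIsotropic lam) 𝔭.toSubmodule

/-- The stabilizer `{x | lam([x, y]) = 0 for all y}` of `lam` in the Lie algebra. -/
def stabilizer (lam : Module.Dual K L) : Submodule K L :=
  LinearMap.ker (kirillovForm lam)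

/-- The dimension `dim L - dim (stabilizer of lam)` of the coadjoint orbit of `lam`.
The subtraction does not truncate, the stabilizer being a subspace. -/
def orbitDim (lam : Module.Dual K L) : ℕ :=
  Module.finrank K L - Module.finrank K (stabilizer lam)

end Lie

/-! ### The exponential map in characteristic `p` -/

section Exp

variable {K : Type*} [Field K] {N : ℕ}

/-- The exponential polynomial `∑_{k < p} x ^ k / k!`. -/
def texp (p : ℕ) (x : Matrix (Fin N) (Fin N) K) : Matrix (Fin N) (Fin N) K :=
  ∑ k ∈ Finset.range p, ((k ! : K)⁻¹) • x ^ k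

/-- `𝔤` is a Lie algebra of strictly upper triangular matrices, and `p` is large enough for the
exponential series on `𝔤`: every product of `p` elements of `𝔤` vanishes. The second condition
holds whenever `N ≤ p`. -/
structure IsAdmissible (p : ℕ) (𝔤 : LieSubalgebra K (Matrix (Fin N) (Fin N) K)) : Prop where
  strictUpper : ∀ x ∈ 𝔤, ∀ i j : Fin N, j ≤ i → x i j = 0
  prod_eq_zero : ∀ l : List (Matrix (Fin N) (Fin N) K),
    (∀ x ∈ l, x ∈ 𝔤) → l.length = p → l.prod = 0

variable {p : ℕ} {𝔤 : LieSubalgebra K (Matrix (Fin N) (Fin N) K)}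

/-- For strictly upper triangular matrices of size `N ≤ p` the second condition is automatic. -/
theorem IsAdmissible.of_le (hN : N ≤ p)
    (hu : ∀ x ∈ 𝔤, ∀ i j : Fin N, j ≤ i → x i j = 0) : IsAdmissible p 𝔤 := by
  refine ⟨hu, fun l hl hlen => ?_⟩
  have key : ∀ m : List (Matrix (Fin N) (Fin N) K), (∀ x ∈ m, x ∈ 𝔤) →
      ∀ i j : Fin N, (j : ℕ) < i + m.length → m.prod i j = 0 := by
    intro m
    induction m with
    | nil =>
      intro _ i j hij
      rw [List.prod_nil, Matrix.one_apply_ne]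
      rintro rfl
      simp at hij
    | cons x m ih =>
      intro hm i j hij
      rw [List.prod_cons, Matrix.mul_apply]
      refine Finset.sum_eq_zero fun k _ => ?_
      by_cases hk : k ≤ i
      · rw [hu x (hm x (by simp)) i k hk, zero_mul]
      · rw [ih (fun z hz => hm z (by simp [hz])) k j, mul_zero]
        have : (i : ℕ) < k := by simpa using hk
        simp only [List.length_cons] at hij
        omega
  ext i j
  exact key l hl i j (by omega)

theorem IsAdmissible.prod_eq_zero_of_le (h : IsAdmissible p 𝔤)
    (l : List (Matrix (Fin N) (Fin N) K)) (hl : ∀ x ∈ l, x ∈ 𝔤) (hp : p ≤ l.length) :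
    l.prod = 0 := by
  rw [← List.prod_take_mul_prod_drop l p,
    h.prod_eq_zero (l.take p) (fun x hx => hl x (List.mem_of_mem_take hx))
      (by simp [hp]), zero_mul]

theorem IsAdmissible.pow_eq_zero (h : IsAdmissible p 𝔤) {x : Matrix (Fin N) (Fin N) K}
    (hx : x ∈ 𝔤) : x ^ p = 0 := by
  rw [← List.prod_replicate]
  exact h.prod_eq_zero _ (fun y hy => (List.eq_of_mem_replicate hy) ▸ hx) (by simp)

theorem isUnit_texp [CharP K p] [Fact p.Prime] (h : IsAdmissible p 𝔤)
    {x : Matrix (Fin N) (Fin N) K} (hx : x ∈ 𝔤) : IsUnit (texp p x) := by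
  have hn : IsNilpotent x := ⟨p, h.pow_eq_zero hx⟩
  obtain ⟨m, rfl⟩ : ∃ m, p = m + 1 :=
    ⟨p - 1, (Nat.succ_pred_eq_of_pos (Fact.out : p.Prime).pos).symm⟩
  rw [texp, Finset.sum_range_succ']
  simp only [Nat.factorial_zero, Nat.cast_one, inv_one, pow_zero, one_smul]
  refine IsNilpotent.isUnit_add_one ?_
  refine Commute.isNilpotent_sum (fun k _ => ?_) (fun i j _ _ => ?_)
  · exact (hn.pow_succ k).smul _
  · exact ((Commute.refl x).pow_pow _ _).smul_left _ |>.smul_right _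

/-- The subgroup `G` generated by the matrices `exp x`, `x ∈ 𝔤`. -/
def expGroup (p : ℕ) (𝔤 : LieSubalgebra K (Matrix (Fin N) (Fin N) K)) :
    Subgroup (GL (Fin N) K) :=
  Subgroup.closure {u | ∃ x ∈ 𝔤, (u : Matrix (Fin N) (Fin N) K) = texp p x}

/-- The exponential map `𝔤 → G`. -/
def expMap [CharP K p] [Fact p.Prime] (h : IsAdmissible p 𝔤) (x : 𝔤) : expGroup p 𝔤 :=
  ⟨(isUnit_texp h x.2).unit, Subgroup.subset_closure ⟨x, x.2, rfl⟩⟩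

/-- The subgroup of `G` generated by the elements `exp x`, `x ∈ 𝔭`, for a subalgebra `𝔭`
of `𝔤`. -/
def expSubgroup [CharP K p] [Fact p.Prime] (h : IsAdmissible p 𝔤) (𝔭 : LieSubalgebra K 𝔤) :
    Subgroup (expGroup p 𝔤) :=
  Subgroup.closure (expMap h '' (𝔭 : Set 𝔤))

/-! ### The adjoint and coadjoint representations -/

/-- Products with `ad x`-iterates of elements of `𝔤` vanish in high degree. -/
theorem ad_pow_vanish (h : IsAdmissible p 𝔤) {x y : Matrix (Fin N) (Fin N) K}
    (hx : x ∈ 𝔤) (hy : y ∈ 𝔤) (i : ℕ) :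
    ∀ a b : List (Matrix (Fin N) (Fin N) K), (∀ z ∈ a, z ∈ 𝔤) → (∀ z ∈ b, z ∈ 𝔤) →
      p ≤ a.length + i + 1 + b.length →
      a.prod * ((LieAlgebra.ad K (Matrix (Fin N) (Fin N) K) x) ^ i) y * b.prod = 0 := by
  induction i with
  | zero =>
    intro a b ha hb hab
    have := h.prod_eq_zero_of_le (a ++ y :: b)
      (by
        intro z hz
        rcases List.mem_append.1 hz with hz | hz
        · exact ha z hz
        · rcases List.mem_cons.1 hz with rfl | hz
          · exact hy
          · exact hb z hz)
      (by simp; omega)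
    simpa [mul_assoc] using this
  | succ i ih =>
    intro a b ha hb hab
    have h1 := ih (a ++ [x]) b
      (by
        intro z hz
        rcases List.mem_append.1 hz with hz | hz
        · exact ha z hz
        · rw [List.mem_singleton.1 hz]; exact hx) hb
      (by simp; omega)
    have h2 := ih a (x :: b) ha
      (by
        intro z hz
        rcases List.mem_cons.1 hz with rfl | hz
        · exact hx
        · exact hb z hz)
      (by simp; omega)
    rw [pow_succ', Module.End.mul_apply, LieAlgebra.ad_apply, Ring.lie_def, mul_sub, sub_mul]
    simp only [List.prod_append, List.prod_cons, List.prod_nil, mul_one] at h1 h2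
    simp only [mul_assoc] at h1 h2 ⊢
    rw [h1, h2, sub_zero]

theorem ad_pow_mem {x y : Matrix (Fin N) (Fin N) K} (hx : x ∈ 𝔤) (hy : y ∈ 𝔤) (i : ℕ) :
    ((LieAlgebra.ad K (Matrix (Fin N) (Fin N) K) x) ^ i) y ∈ 𝔤 := by
  induction i with
  | zero => simpa using hy
  | succ i ih =>
    rw [pow_succ', Module.End.mul_apply, LieAlgebra.ad_apply]
    exact 𝔤.lie_mem hx ih

theorem factorial_cast_ne_zero [CharP K p] [Fact p.Prime] {k : ℕ} (hk : k < p) :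
    (k ! : K) ≠ 0 := by
  rw [Ne, CharP.cast_eq_zero_iff K p, (Fact.out : p.Prime).dvd_factorial]
  omega

/-- `exp(x) y = (exp(ad x) y) exp(x)`. -/
theorem texp_mul [CharP K p] [Fact p.Prime] (h : IsAdmissible p 𝔤)
    {x y : Matrix (Fin N) (Fin N) K} (hx : x ∈ 𝔤) (hy : y ∈ 𝔤) :
    texp p x * y = (∑ i ∈ Finset.range p, ((i ! : K)⁻¹) •
      ((LieAlgebra.ad K (Matrix (Fin N) (Fin N) K) x) ^ i) y) * texp p x := by
  set D := LieAlgebra.ad K (Matrix (Fin N) (Fin N) K) x with hD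
  set f : ℕ → ℕ → Matrix (Fin N) (Fin N) K :=
    fun i j => ((i ! : K)⁻¹ * (j ! : K)⁻¹) • ((D ^ i) y * x ^ j) with hf
  have hL : ∀ n, x ^ n * y = ∑ k ∈ Finset.range (n + 1), (n.choose k : K) •
      ((D ^ k) y * x ^ (n - k)) := by
    intro n
    have hc : Commute D (LinearMap.mulRight K x) := by
      refine LinearMap.ext fun z => ?_
      simp [hD, Ring.lie_def, sub_mul, mul_assoc]
    have hs : LinearMap.mulLeft K x = D + LinearMap.mulRight K x := by
      refine LinearMap.ext fun z => ?_
      simp [hD, Ring.lie_def]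
    have h1 : (LinearMap.mulLeft K x ^ n) y = x ^ n * y := by
      simp
    rw [← h1, hs, hc.add_pow, LinearMap.sum_apply]
    refine Finset.sum_congr rfl fun k _ => ?_
    rw [hc.pow_pow k (n - k) |>.eq, ← (Nat.cast_commute _ _).eq, ← nsmul_eq_mul,
      LinearMap.smul_apply, Module.End.mul_apply, LinearMap.pow_mulRight, LinearMap.mulRight_apply,
      Nat.cast_smul_eq_nsmul]
  have h2 : texp p x * y = ∑ n ∈ Finset.range p, ∑ k ∈ Finset.range (n + 1), f k (n - k) := by
    rw [texp, Finset.sum_mul]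
    refine Finset.sum_congr rfl fun n hn => ?_
    rw [smul_mul_assoc, hL, Finset.smul_sum]
    refine Finset.sum_congr rfl fun k hk => ?_
    have hkn : k ≤ n := Nat.lt_succ_iff.1 (Finset.mem_range.1 hk)
    have hnp := Finset.mem_range.1 hn
    rw [hf, smul_smul]
    congr 1
    have e := Nat.choose_mul_factorial_mul_factorial hkn
    have e' : (n.choose k : K) * (k ! : K) * ((n - k)! : K) = (n ! : K) := by
      exact_mod_cast congrArg (Nat.cast : ℕ → K) e
    have a1 : (n ! : K) ≠ 0 := factorial_cast_ne_zero hnp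
    have a2 : (k ! : K) ≠ 0 := factorial_cast_ne_zero (by omega)
    have a3 : ((n - k)! : K) ≠ 0 := factorial_cast_ne_zero (by omega)
    field_simp
    linear_combination e'
  rw [h2, Finset.sum_range_diag_flip, texp, Finset.sum_mul]
  refine Finset.sum_congr rfl fun i hi => ?_
  rw [Finset.mul_sum]
  have h3 : ∀ j, ((i ! : K)⁻¹ • (D ^ i) y) * ((j ! : K)⁻¹ • x ^ j) = f i j := by
    intro j
    rw [smul_mul_smul_comm]
  simp_rw [h3]
  refine Finset.sum_subset (Finset.range_mono (Nat.sub_le _ _)) fun j _ hj' => ?_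
  have := ad_pow_vanish h hx hy i [] (List.replicate j x) (by simp)
    (fun z hz => (List.eq_of_mem_replicate hz) ▸ hx)
    (by simp at hj' ⊢; omega)
  simp only [List.prod_nil, one_mul, List.prod_replicate] at this
  rw [hf]
  simp only
  rw [this, smul_zero]

/-- The group `G` normalizes `𝔤`. -/
theorem conj_mem [CharP K p] [Fact p.Prime] (h : IsAdmissible p 𝔤)
    (g : GL (Fin N) K) (hg : g ∈ expGroup p 𝔤) :
    ∀ y ∈ 𝔤, (g : Matrix (Fin N) (Fin N) K) * y * (g⁻¹ : GL (Fin N) K) ∈ 𝔤 := by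
  rw [expGroup] at hg
  induction hg using Subgroup.closure_induction with
  | mem u hu =>
    obtain ⟨x, hx, hux⟩ := hu
    intro y hy
    rw [hux, texp_mul h hx hy, ← hux, Units.mul_inv_cancel_right]
    exact 𝔤.toSubmodule.sum_mem fun i _ => 𝔤.toSubmodule.smul_mem _ (ad_pow_mem hx hy i)
  | one => intro y hy; simpa using hy
  | mul u v hu hv ihu ihv =>
    intro y hy
    have := ihu _ (ihv y hy)
    rw [mul_inv_rev, Units.val_mul, Units.val_mul]
    simpa only [mul_assoc] using this
  | inv u hu ih =>
    intro y hy
    let c : Matrix (Fin N) (Fin N) K →ₗ[K] Matrix (Fin N) (Fin N) K :=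
      (LinearMap.mulRight K ((u⁻¹ : GL (Fin N) K) : Matrix (Fin N) (Fin N) K)) ∘ₗ
        (LinearMap.mulLeft K (u : Matrix (Fin N) (Fin N) K))
    let f : 𝔤.toSubmodule →ₗ[K] 𝔤.toSubmodule := c.restrict fun z hz => ih z hz
    have key : ∀ z : Matrix (Fin N) (Fin N) K,
        ((u⁻¹ : GL (Fin N) K) : Matrix (Fin N) (Fin N) K) * c z * u = z := by
      intro z
      simp only [c, LinearMap.comp_apply, LinearMap.mulLeft_apply, LinearMap.mulRight_apply]
      rw [mul_assoc, Units.inv_mul_cancel_right, Units.inv_mul_cancel_left]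
    have hinj : Function.Injective f := by
      intro z w hzw
      have e : c z = c w := congrArg Subtype.val hzw
      exact Subtype.ext (by rw [← key z, ← key w, e])
    obtain ⟨z, hz⟩ := (LinearMap.injective_iff_surjective.1 hinj) ⟨y, hy⟩
    have e : c z = y := congrArg Subtype.val hz
    rw [inv_inv, ← e, key]
    exact z.2

/-- The adjoint representation `Ad_g x = g x g⁻¹` of `G` on `𝔤`. -/
def Ad [CharP K p] [Fact p.Prime] (h : IsAdmissible p 𝔤) :
    Representation K (expGroup p 𝔤) 𝔤 where
  toFun g :=
    { toFun := fun x => ⟨((g : GL (Fin N) K) : Matrix (Fin N) (Fin N) K) * x *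
        ((g : GL (Fin N) K)⁻¹ : GL (Fin N) K), conj_mem h g g.2 x x.2⟩
      map_add' := fun x y => Subtype.ext (by simp [mul_add, add_mul])
      map_smul' := fun c x => Subtype.ext (by simp) }
  map_one' := LinearMap.ext fun x => Subtype.ext (by simp)
  map_mul' g g' := LinearMap.ext fun x => Subtype.ext (by simp [mul_assoc])

/-- The coadjoint representation `(Ad*_g lam)(x) = lam(Ad_{g⁻¹} x)` of `G` on the dual of `𝔤`. -/
def coAd [CharP K p] [Fact p.Prime] (h : IsAdmissible p 𝔤) :
    Representation K (expGroup p 𝔤) (Module.Dual K 𝔤) :=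
  (Ad h).dual

/-- The coadjoint orbit of `lam`. -/
def coadjointOrbit [CharP K p] [Fact p.Prime] (h : IsAdmissible p 𝔤) (lam : Module.Dual K 𝔤) :
    Set (Module.Dual K 𝔤) :=
  Set.range fun g : expGroup p 𝔤 => coAd h g lam

/-! ### The representations attached to linear forms -/

/-- `χ` is a homomorphism `P → ℂˣ` with `χ(exp x) = ψ(lam(x))` for all `x ∈ 𝔭`. As the elements
`exp x` generate `P`, there is at most one such `χ`. -/
def IsOrbitCharacter [CharP K p] [Fact p.Prime] (h : IsAdmissible p 𝔤) (ψ : AddChar K ℂ)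
    (lam : Module.Dual K 𝔤) (𝔭 : LieSubalgebra K 𝔤) (χ : expSubgroup h 𝔭 →* ℂˣ) : Prop :=
  ∀ (x : 𝔤) (hx : x ∈ 𝔭),
    (χ ⟨expMap h x, Subgroup.subset_closure (Set.mem_image_of_mem _ hx)⟩ : ℂ) = ψ (lam x)

open Classical in
/-- The character `ξ(exp x) = ψ(lam(x))` of `P` (the trivial character, in case there is no
character with this property). -/
def orbitCharacter [CharP K p] [Fact p.Prime] (h : IsAdmissible p 𝔤) (ψ : AddChar K ℂ)
    (lam : Module.Dual K 𝔤) (𝔭 : LieSubalgebra K 𝔤) : expSubgroup h 𝔭 →* ℂˣ :=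
  if hχ : ∃ χ, IsOrbitCharacter h ψ lam 𝔭 χ then hχ.choose else 1

/-- The one-dimensional representation given by a character. -/
def charRep {P : Type*} [Group P] (χ : P →* ℂˣ) : Representation ℂ P ℂ :=
  (Algebra.lmul ℂ ℂ : ℂ →* Module.End ℂ ℂ).comp ((Units.coeHom ℂ).comp χ)

/-- The underlying space of the induced representation `ind(ξ, P, G)`. -/
abbrev OrbitSpace [CharP K p] [Fact p.Prime] (h : IsAdmissible p 𝔤) (ψ : AddChar K ℂ)
    (lam : Module.Dual K 𝔤) (𝔭 : LieSubalgebra K 𝔤) : Type _ :=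
  Representation.IndV (expSubgroup h 𝔭).subtype (charRep (orbitCharacter h ψ lam 𝔭))

/-- The induced representation `ind(ξ, P, G)`. -/
def orbitRep [CharP K p] [Fact p.Prime] (h : IsAdmissible p 𝔤) (ψ : AddChar K ℂ)
    (lam : Module.Dual K 𝔤) (𝔭 : LieSubalgebra K 𝔤) :
    Representation ℂ (expGroup p 𝔤) (OrbitSpace h ψ lam 𝔭) :=
  Representation.ind (expSubgroup h 𝔭).subtype (charRep (orbitCharacter h ψ lam 𝔭))

end Exp

end OrbitMethod

end

noncomputable section

namespace OrbitMethod

/-! ### Truncated exponentials and nilpotent filtrations -/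

section NilExp

variable (K : Type*) [Field K] {B : Type*} [Ring B] [Algebra K B]

/-! The proof works with characters and constructs no intertwining operators.

On the group side the main tool is a truncated Baker–Campbell–Hausdorff theorem,
`exists_nilExp_mul_nilExp`. The logarithm `z` of `exp (x X) * exp y` satisfies a differential
equation in `R[X]`, and the resulting recursion for its coefficients uses only brackets and division
by integers below `p`. Hence `exp` is a bijection onto `G` and `P = exp 𝔭`. Moreover `ψ ∘ lam ∘ log`
is multiplicative on `P`, because `z` is `x + y` up to brackets and `lam` kills the brackets of `𝔭`.

On the linear side a polarization is built by enlarging an ideal one dimension at a time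
(`IsRelativePolarization.exists_sup_span`). A polarization is its own orthogonal, so `2 dim 𝔭 = dim
𝔤 + dim 𝔤^lam`. The stabilizer of `lam` in `G` is `exp 𝔤^lam`, which lies in `P`; counting then
shows that the `P`-orbit of `lam` fills `lam + 𝔭^⊥`. Averaging `ψ` over this affine space gives `ξ`
extended by zero (`extendedCharacter_eq`), and the formula for induced characters becomes
Kirillov's: the character at `exp x` is `|P|⁻¹ ∑_g ψ((Ad*_g lam)(x))` (`character_orbitRep`).

The rest is orthogonality of additive characters on `𝔤`. The inner product of two such characters is
`|P|⁻¹ |P'|⁻¹` times the number of pairs `(s, t)` with `Ad*_s lam = Ad*_t lam'`. It is `1` when the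
two forms and polarizations coincide, and nonzero exactly when the orbits meet, which gives
irreducibility, independence of the polarization and the classification. The value at `1` gives the
dimension. For exhaustion, the orbit sums added over all `lam` form a nonzero multiple of the delta
function at `1`, to which no irreducible character is orthogonal. -/

/-- The truncated exponential series `∑_{k < p} x ^ k / k!` in a `K`-algebra. -/
def nilExp (p : ℕ) (x : B) : B :=
  ∑ k ∈ Finset.range p, ((k ! : K)⁻¹) • x ^ k

variable {K}

/-- A decreasing multiplicative filtration by subspaces which vanishes from degree `p` on. -/
structure IsNilFiltration (p : ℕ) (F : ℕ → Submodule K B) : Prop where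
  mul_mem : ∀ {a b : ℕ} {x y : B}, x ∈ F a → y ∈ F b → x * y ∈ F (a + b)
  anti : Antitone F
  eq_bot : F p = ⊥

theorem nilExp_add_two (m : ℕ) (x : B) :
    nilExp K (m + 2) x = (∑ k ∈ Finset.range m, (((k + 2)! : K)⁻¹) • x ^ (k + 2)) + x + 1 := by
  rw [nilExp, Finset.sum_range_succ', Finset.sum_range_succ']
  simp

theorem nilExp_zero {p : ℕ} (hp : 2 ≤ p) : nilExp K p (0 : B) = 1 := by
  obtain ⟨m, rfl⟩ := Nat.exists_eq_add_of_le' hp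
  simp [nilExp_add_two]

theorem map_nilExp {C : Type*} [Ring C] [Algebra K C] (f : B →ₐ[K] C) (p : ℕ) (x : B) :
    f (nilExp K p x) = nilExp K p (f x) := by
  simp [nilExp]

namespace IsNilFiltration

variable {p : ℕ} {F : ℕ → Submodule K B} (hF : IsNilFiltration p F)
include hF

theorem eq_zero {n : ℕ} (hn : p ≤ n) {x : B} (hx : x ∈ F n) : x = 0 := by
  have := hF.anti hn hx
  rwa [hF.eq_bot, Submodule.mem_bot] at this

theorem pow_succ_mem {x : B} (hx : x ∈ F 1) (k : ℕ) : x ^ (k + 1) ∈ F (k + 1) := by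
  induction k with
  | zero => simpa using hx
  | succ k ih => rw [pow_succ]; exact hF.mul_mem ih hx

theorem isNilpotent {x : B} (hx : x ∈ F 1) : IsNilpotent x :=
  ⟨p + 1, hF.eq_zero p.le_succ (hF.pow_succ_mem hx p)⟩

/-- Telescoping: `x^(k+2) - y^(k+2) = x^(k+1) (x - y) + (x^(k+1) - y^(k+1)) y`. -/
theorem pow_sub_pow_mem {x y : B} (hx : x ∈ F 1) (hy : y ∈ F 1) {m : ℕ} (hxy : x - y ∈ F m)
    (k : ℕ) : x ^ (k + 1) - y ^ (k + 1) ∈ F (m + k) := by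
  induction k with
  | zero => simpa using hxy
  | succ k ih =>
    have h1 := hF.mul_mem (hF.pow_succ_mem hx k) hxy
    have h2 := hF.mul_mem ih hy
    rw [show k + 1 + m = m + (k + 1) by ring] at h1
    have := (F (m + (k + 1))).add_mem h1 h2
    convert this using 1
    rw [pow_succ x (k + 1), pow_succ y (k + 1)]
    noncomm_ring

/-- To first order `exp` is a translation: in the terms of degree at least two, a difference gains
at least one step of the filtration. Injectivity and surjectivity of `exp` are both iterations of
this estimate. -/
theorem nilExp_sub_nilExp_sub_mem (hp : 2 ≤ p) {x y : B} (hx : x ∈ F 1) (hy : y ∈ F 1) {m : ℕ}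
    (hxy : x - y ∈ F m) : nilExp K p x - nilExp K p y - (x - y) ∈ F (m + 1) := by
  obtain ⟨n, hn⟩ := Nat.exists_eq_add_of_le' hp
  rw [hn, nilExp_add_two, nilExp_add_two]
  have e : ∀ a b : B, a + x + 1 - (b + y + 1) - (x - y) = a - b := fun a b => by abel
  rw [e, ← Finset.sum_sub_distrib]
  refine Submodule.sum_mem _ fun k _ => ?_
  rw [← smul_sub]
  exact Submodule.smul_mem _ _ (hF.anti (by omega) (hF.pow_sub_pow_mem hx hy hxy (k + 1)))

theorem nilExp_sub_one_mem (hp : 2 ≤ p) {x : B} (hx : x ∈ F 1) : nilExp K p x - 1 ∈ F 1 := by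
  have := hF.nilExp_sub_nilExp_sub_mem hp hx (F 1).zero_mem (m := 1) (by simpa using hx)
  rw [nilExp_zero hp, sub_zero] at this
  simpa using (F 1).add_mem (hF.anti (by omega) this) hx

theorem mul_sub_one_mem {x y : B} (hx : x - 1 ∈ F 1) (hy : y - 1 ∈ F 1) : x * y - 1 ∈ F 1 := by
  have h := (F 1).add_mem ((F 1).add_mem (hF.anti one_le_two (hF.mul_mem hx hy)) hx) hy
  convert h using 1
  noncomm_ring

theorem isUnit_nilExp (hp : 2 ≤ p) {x : B} (hx : x ∈ F 1) : IsUnit (nilExp K p x) := by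
  simpa using (hF.isNilpotent (hF.nilExp_sub_one_mem hp hx)).isUnit_add_one

theorem nilExp_injOn (hp : 2 ≤ p) {x y : B} (hx : x ∈ F 1) (hy : y ∈ F 1)
    (hxy : nilExp K p x = nilExp K p y) : x = y := by
  have key : ∀ m, x - y ∈ F (m + 1) := by
    intro m
    induction m with
    | zero => exact (F 1).sub_mem hx hy
    | succ m ih => simpa [hxy] using (F _).neg_mem (hF.nilExp_sub_nilExp_sub_mem hp hx hy ih)
  exact sub_eq_zero.1 (hF.eq_zero p.le_succ (key p))

theorem exists_nilExp_eq (hp : 2 ≤ p) {a : B} (ha : a - 1 ∈ F 1) :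
    ∃ z ∈ F 1, nilExp K p z = a := by
  have key : ∀ m, ∃ z ∈ F 1, nilExp K p z - a ∈ F (m + 1) := by
    intro m
    induction m with
    | zero =>
      refine ⟨0, (F 1).zero_mem, ?_⟩
      rw [nilExp_zero hp]
      simpa using (F 1).neg_mem ha
    | succ m ih =>
      obtain ⟨z, hz, hza⟩ := ih
      set e := nilExp K p z - a with he
      have he1 : e ∈ F 1 := hF.anti (by omega) hza
      -- A Newton step: subtracting the error `e` cancels it up to the next degree.
      refine ⟨z - e, (F 1).sub_mem hz he1, ?_⟩
      have h1 := hF.nilExp_sub_nilExp_sub_mem hp ((F 1).sub_mem hz he1) hz (m := m + 1)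
        (by simpa using hza)
      convert h1 using 1
      rw [he]
      abel
  obtain ⟨z, hz, hza⟩ := key p
  exact ⟨z, hz, sub_eq_zero.1 (hF.eq_zero p.le_succ hza)⟩

theorem ad_pow_mem {z w : B} (hz : z ∈ F 1) {m : ℕ} (hw : w ∈ F m) (k : ℕ) :
    ((LieAlgebra.ad K B z) ^ k) w ∈ F (m + k) := by
  induction k with
  | zero => simpa using hw
  | succ k ih =>
    rw [pow_succ', Module.End.mul_apply, LieAlgebra.ad_apply, Ring.lie_def]
    have h1 := hF.mul_mem ih hz
    refine (F _).sub_mem ?_ h1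
    rw [show m + (k + 1) = 1 + (m + k) by ring]
    exact hF.mul_mem hz ih

end IsNilFiltration

/-- All factors `z` are moved to the right of `D z` by `z a = [z, a] + a z`; Pascal's rule carries
the induction. -/
theorem derivation_pow_succ (D : B →ₗ[K] B) (hD : ∀ a b, D (a * b) = D a * b + a * D b) (z : B)
    (n : ℕ) : D (z ^ (n + 1)) = ∑ k ∈ Finset.range (n + 1),
      ((n + 1).choose (k + 1) : K) • (((LieAlgebra.ad K B z) ^ k) (D z) * z ^ (n - k)) := by
  induction n with
  | zero => simp
  | succ n ih =>
    set w := D z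
    set A := LieAlgebra.ad K B z with hA
    have h1 : ∀ k, z * ((A ^ k) w * z ^ (n - k)) =
        (A ^ (k + 1)) w * z ^ (n - k) + (A ^ k) w * z ^ (n - k + 1) := by
      intro k
      rw [pow_succ' A, Module.End.mul_apply, hA, LieAlgebra.ad_apply, Ring.lie_def, pow_succ' z]
      noncomm_ring
    rw [pow_succ' z, hD, ih, Finset.mul_sum]
    simp_rw [mul_smul_comm, h1, smul_add, Finset.sum_add_distrib]
    rw [Finset.sum_range_succ' _ (n + 1)]
    have h2 : ∀ k, (((n + 1 + 1).choose (k + 1 + 1) : ℕ) : K) •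
        ((A ^ (k + 1)) w * z ^ (n + 1 - (k + 1))) =
        ((n + 1).choose (k + 1) : K) • ((A ^ (k + 1)) w * z ^ (n - k)) +
        ((n + 1).choose (k + 2) : K) • ((A ^ (k + 1)) w * z ^ (n - k)) := by
      intro k
      rw [Nat.choose_succ_succ, Nat.cast_add, add_smul, Nat.add_sub_add_right]
    simp_rw [h2, Finset.sum_add_distrib]
    have h3 : ∑ k ∈ Finset.range (n + 1), ((n + 1).choose (k + 1) : K) •
          ((A ^ k) w * z ^ (n - k + 1)) =
        (∑ k ∈ Finset.range (n + 1), ((n + 1).choose (k + 2) : K) •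
          ((A ^ (k + 1)) w * z ^ (n - k))) + (n + 1 : K) • (w * z ^ (n + 1)) := by
      rw [Finset.sum_range_succ', Finset.sum_range_succ _ n]
      have : (n + 1).choose (n + 2) = 0 := Nat.choose_succ_self _
      simp only [this, Nat.cast_zero, zero_smul, add_zero]
      congr 1
      · refine Finset.sum_congr rfl fun k hk => ?_
        rw [show n - (k + 1) + 1 = n - k by have := Finset.mem_range.1 hk; omega]
      · simp
    rw [h3]
    simp only [zero_add, Nat.choose_one_right, pow_zero, Module.End.one_apply, Nat.sub_zero]
    push_cast
    module

/-- The formula for the derivative of the exponential. -/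
theorem IsNilFiltration.derivation_nilExp {p : ℕ} [CharP K p] [Fact p.Prime]
    {F : ℕ → Submodule K B} (hF : IsNilFiltration p F) (D : B →ₗ[K] B)
    (hD : ∀ a b, D (a * b) = D a * b + a * D b) {z : B} (hz : z ∈ F 1) (hw : D z ∈ F 1) :
    D (nilExp K p z) = (∑ k ∈ Finset.range (p - 1),
      (((k + 1)! : K)⁻¹) • ((LieAlgebra.ad K B z) ^ k) (D z)) * nilExp K p z := by
  obtain ⟨m, hm⟩ : ∃ m, p = m + 1 :=
    ⟨p - 1, (Nat.succ_pred_eq_of_pos (Fact.out : p.Prime).pos).symm⟩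
  have hpm : p - 1 = m := by omega
  set w := D z with hwdef
  set A := LieAlgebra.ad K B z with hA
  set f : ℕ → ℕ → B :=
    fun i j => (((i + 1)! : K)⁻¹ * (j ! : K)⁻¹) • ((A ^ i) w * z ^ j) with hf
  have hone : D 1 = 0 := by simpa using hD 1 1
  have h2 : D (nilExp K p z) = ∑ n ∈ Finset.range m, ∑ k ∈ Finset.range (n + 1), f k (n - k) := by
    rw [nilExp, hm, map_sum, Finset.sum_range_succ']
    simp only [map_smul, pow_zero, hone, smul_zero, add_zero]
    refine Finset.sum_congr rfl fun n hn => ?_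
    rw [derivation_pow_succ D hD, Finset.smul_sum]
    refine Finset.sum_congr rfl fun k hk => ?_
    have hkn : k ≤ n := Nat.lt_succ_iff.1 (Finset.mem_range.1 hk)
    have hnp := Finset.mem_range.1 hn
    rw [hf, smul_smul]
    congr 1
    have e := Nat.choose_mul_factorial_mul_factorial (Nat.succ_le_succ hkn)
    rw [Nat.succ_sub_succ] at e
    have e' : ((n + 1).choose (k + 1) : K) * ((k + 1)! : K) * ((n - k)! : K) = ((n + 1)! : K) := by
      exact_mod_cast congrArg (Nat.cast : ℕ → K) e
    have a1 : ((n + 1)! : K) ≠ 0 := factorial_cast_ne_zero (p := p) (by omega)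
    have a2 : ((k + 1)! : K) ≠ 0 := factorial_cast_ne_zero (p := p) (by omega)
    have a3 : ((n - k)! : K) ≠ 0 := factorial_cast_ne_zero (p := p) (by omega)
    field_simp
    linear_combination e'
  rw [h2, Finset.sum_range_diag_flip, nilExp, Finset.sum_mul, hpm]
  refine Finset.sum_congr rfl fun i hi => ?_
  rw [Finset.mul_sum]
  simp_rw [smul_mul_smul_comm]
  -- The product of the two truncated series has additional terms with `i + j ≥ p - 1`. They have
  -- filtration degree at least `1 + i + j`, hence vanish.
  refine Finset.sum_subset (Finset.range_mono (by omega)) fun j _ hj' => ?_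
  have hi' := Finset.mem_range.1 hi
  rw [Finset.mem_range, not_lt] at hj'
  have hj0 : j ≠ 0 := by omega
  obtain ⟨j, rfl⟩ := Nat.exists_eq_succ_of_ne_zero hj0
  change _ • ((A ^ i) w * z ^ (j + 1)) = 0
  rw [hF.eq_zero (n := 1 + i + (j + 1)) (by omega)
    (hF.mul_mem (hF.ad_pow_mem hz hw i) (hF.pow_succ_mem hz j)), smul_zero]

end NilExp

/-! ### Inverting the series `(exp u - 1) / u` -/

section Inverse

open Polynomial

variable (K : Type*) [Field K]

/-- The truncation of the series `(exp u - 1) / u`. -/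
def expQuotient (p : ℕ) : K[X] :=
  ∑ k ∈ Finset.range (p - 1), C (((k + 1)! : K)⁻¹) * X ^ k

/-- The constant coefficient is `1`, so a truncated geometric series inverts the polynomial modulo
`X ^ (p - 1)`. -/
theorem exists_expQuotient_inverse {p : ℕ} (hp : 2 ≤ p) :
    ∃ b : K[X], b.coeff 0 = 1 ∧ X ^ (p - 1) ∣ b * expQuotient K p - 1 := by
  obtain ⟨n, rfl⟩ := Nat.exists_eq_add_of_le' hp
  obtain ⟨q, hq⟩ : X ∣ expQuotient K (n + 2) - 1 := by
    rw [X_dvd_iff, expQuotient, show n + 2 - 1 = n + 1 by omega, Finset.sum_range_succ']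
    simp
  refine ⟨∑ i ∈ Finset.range (n + 1), (-(X * q)) ^ i, ?_, ?_⟩
  · rw [Finset.sum_range_succ']
    simp [pow_succ]
  · have h1 := geom_sum_mul (-(X * q)) (n + 1)
    have h2 : expQuotient K (n + 2) = 1 + X * q := by rw [← hq]; ring
    refine ⟨-(-q) ^ (n + 1), ?_⟩
    rw [h2, show n + 2 - 1 = n + 1 by omega]
    have h3 : (-(X * q)) ^ (n + 1) = X ^ (n + 1) * (-q) ^ (n + 1) := by rw [← mul_pow]; ring
    rw [h3] at h1
    linear_combination -h1

theorem aeval_expQuotient {E : Type*} [AddCommGroup E] [Module K E] (p : ℕ)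
    (A : Module.End K E) (w : E) :
    aeval A (expQuotient K p) w =
      ∑ k ∈ Finset.range (p - 1), (((k + 1)! : K)⁻¹) • (A ^ k) w := by
  simp [expQuotient, LinearMap.sum_apply, Module.algebraMap_end_apply]

variable {K} in
/-- If `A ^ (p - 1)` kills `w`, then `w` is recovered from `((exp A - 1) / A) w`. -/
theorem aeval_expQuotient_inverse_apply {E : Type*} [AddCommGroup E] [Module K E] {p : ℕ} {b : K[X]}
    (hb : X ^ (p - 1) ∣ b * expQuotient K p - 1) {A : Module.End K E} {w : E}
    (hw : (A ^ (p - 1)) w = 0) : aeval A b (aeval A (expQuotient K p) w) = w := by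
  obtain ⟨c, hc⟩ := hb
  have h1 : b * expQuotient K p = c * X ^ (p - 1) + 1 := by rw [mul_comm c, ← hc]; ring
  rw [← Module.End.mul_apply, ← map_mul, h1]
  simp [hw]

end Inverse

/-! ### The Baker–Campbell–Hausdorff theorem -/

section BCH

open Polynomial

variable {K : Type*} [Field K] {R : Type*} [Ring R] [Algebra K R] {p : ℕ}

/-- The filtration of `R[X]` by the conditions `f n ∈ F (max m n)` on the coefficients. -/
def reesFiltration (F : ℕ → Submodule K R) (m : ℕ) : Submodule K R[X] where
  carrier := {f | ∀ n, f.coeff n ∈ F (max m n)}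
  add_mem' := fun hf hg n => by rw [coeff_add]; exact (F _).add_mem (hf n) (hg n)
  zero_mem' := fun n => by rw [coeff_zero]; exact (F _).zero_mem
  smul_mem' := fun c f hf n => by rw [coeff_smul]; exact (F _).smul_mem c (hf n)

/-- The bound by `m` makes the filtration vanish at `p`. The bound by `n` kills the coefficients
from `X ^ p` on, exactly where the recursion for the logarithm would start dividing by `p`. -/
theorem IsNilFiltration.rees {F : ℕ → Submodule K R} (hF : IsNilFiltration p F) :
    IsNilFiltration p (reesFiltration F) where
  mul_mem := by
    intro a b f g hf hg n
    rw [coeff_mul]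
    refine Submodule.sum_mem _ fun ij hij => ?_
    have hn := Finset.HasAntidiagonal.mem_antidiagonal.1 hij
    exact hF.anti (by omega) (hF.mul_mem (hf ij.1) (hg ij.2))
  anti := fun a b hab f hf n => hF.anti (max_le_max_right n hab) (hf n)
  eq_bot := by
    refine (Submodule.eq_bot_iff _).2 fun f hf => ?_
    ext n
    exact hF.eq_zero (le_max_left _ _) (hf n)

/-- The span of the products of at least `n` elements of `L`. -/
def productFiltration (L : LieSubalgebra K R) (n : ℕ) : Submodule K R :=
  Submodule.span K {a | ∃ l : List R, (∀ x ∈ l, x ∈ L) ∧ n ≤ l.length ∧ l.prod = a}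

theorem mem_productFiltration_one {L : LieSubalgebra K R} {x : R} (hx : x ∈ L) :
    x ∈ productFiltration L 1 :=
  Submodule.subset_span ⟨[x], by simpa using hx, by simp, by simp⟩

theorem isNilFiltration_productFiltration {L : LieSubalgebra K R}
    (hL : ∀ l : List R, (∀ x ∈ l, x ∈ L) → l.length = p → l.prod = 0) :
    IsNilFiltration p (productFiltration L) where
  mul_mem := by
    intro a b x y hx hy
    have := Submodule.mul_mem_mul hx hy
    rw [productFiltration, productFiltration, Submodule.span_mul_span] at this
    refine Submodule.span_mono ?_ this
    rintro _ ⟨_, ⟨l, hl, hla, rfl⟩, _, ⟨l', hl', hla', rfl⟩, rfl⟩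
    refine ⟨l ++ l', fun z hz => ?_, ?_, by simp⟩
    · exact (List.mem_append.1 hz).elim (hl z) (hl' z)
    · rw [List.length_append]; omega
  anti := by
    intro a b hab
    refine Submodule.span_mono ?_
    rintro _ ⟨l, hl, hla, rfl⟩
    exact ⟨l, hl, hab.trans hla, rfl⟩
  eq_bot := by
    rw [productFiltration, Submodule.span_eq_bot]
    rintro _ ⟨l, hl, hlp, rfl⟩
    rw [← List.prod_take_mul_prod_drop l p,
      hL (l.take p) (fun x hx => hl x (List.mem_of_mem_take hx)) (by simp [hlp]), zero_mul]

/-- The derivative as a `K`-linear endomorphism of `R[X]`. -/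
def polyDerivative (K : Type*) [Field K] (R : Type*) [Ring R] [Algebra K R] : R[X] →ₗ[K] R[X] where
  toFun := derivative
  map_add' _ _ := derivative_add
  map_smul' c f := derivative_smul c f

theorem polyDerivative_mul (f g : R[X]) : polyDerivative K R (f * g) =
    polyDerivative K R f * g + f * polyDerivative K R g :=
  derivative_mul

theorem polyDerivative_mem_rees {F : ℕ → Submodule K R} (hF : IsNilFiltration p F) {m : ℕ}
    {f : R[X]} (hf : f ∈ reesFiltration F m) : polyDerivative K R f ∈ reesFiltration F m := by
  intro n
  change (derivative f).coeff n ∈ _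
  rw [coeff_derivative]
  have h1 : f.coeff (n + 1) * ((n : R) + 1) = ((n : K) + 1) • f.coeff (n + 1) := by
    rw [← Nat.cast_succ, ← Nat.cast_succ, ← (Nat.cast_commute _ _).eq, ← nsmul_eq_mul,
      Nat.cast_smul_eq_nsmul]
  rw [h1]
  exact Submodule.smul_mem _ _ (hF.anti (by omega) (hf (n + 1)))

theorem derivative_nilExp_of_commute [CharP K p] [Fact p.Prime] {F : ℕ → Submodule K R[X]}
    (hF : IsNilFiltration p F) {f : R[X]} (hf : f ∈ F 1) (hf' : polyDerivative K R f ∈ F 1)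
    (hc : Commute f (polyDerivative K R f)) :
    polyDerivative K R (nilExp K p f) = polyDerivative K R f * nilExp K p f := by
  rw [hF.derivation_nilExp _ polyDerivative_mul hf hf']
  congr 1
  have hp := (Fact.out : p.Prime).two_le
  rw [show p - 1 = (p - 2) + 1 by omega, Finset.sum_range_succ']
  have h0 : ∀ k, ((LieAlgebra.ad K R[X] f) ^ (k + 1)) (polyDerivative K R f) = 0 := by
    intro k
    rw [pow_succ, Module.End.mul_apply, LieAlgebra.ad_apply, hc.lie_eq, map_zero]
  simp [h0]

theorem coeff_lie (f g : R[X]) (n : ℕ) :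
    ⁅f, g⁆.coeff n = ∑ ij ∈ Finset.HasAntidiagonal.antidiagonal n, ⁅f.coeff ij.1, g.coeff ij.2⁆ := by
  rw [Ring.lie_def, coeff_sub, coeff_mul, coeff_mul,
    ← Finset.Nat.sum_antidiagonal_swap (n := n) (f := fun ij : ℕ × ℕ => g.coeff ij.1 * f.coeff ij.2),
    ← Finset.sum_sub_distrib]
  rfl

/-- The coefficients up to degree `n` involve only those of `z` up to degree `n`, so the
differential equation determines coefficient `n + 1` of `z` from brackets of earlier ones. -/
theorem coeff_ad_pow_mem {L : LieSubalgebra K R} {z : R[X]} {x : R} (hx : x ∈ L) {n : ℕ}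
    (hz : ∀ i ≤ n, z.coeff i ∈ L) (k : ℕ) :
    ∀ i ≤ n, (((LieAlgebra.ad K R[X] z) ^ k) (C x)).coeff i ∈ L := by
  induction k with
  | zero =>
    intro i _
    rw [pow_zero, Module.End.one_apply, coeff_C]
    split_ifs
    · exact hx
    · exact L.zero_mem
  | succ k ih =>
    intro i hi
    rw [pow_succ', Module.End.mul_apply, LieAlgebra.ad_apply, coeff_lie]
    refine L.toSubmodule.sum_mem fun ij hij => ?_
    have hij := Finset.HasAntidiagonal.mem_antidiagonal.1 hij
    exact L.lie_mem (hz ij.1 (by omega)) (ih ij.2 (by omega))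

theorem coeff_ad_pow_succ_mem {L : LieSubalgebra K R} {D : Submodule K R}
    (hD : ∀ x ∈ L, ∀ y ∈ L, ⁅x, y⁆ ∈ D) {z : R[X]} {x : R} (hx : x ∈ L) {n : ℕ}
    (hz : ∀ i ≤ n, z.coeff i ∈ L) (k : ℕ) :
    (((LieAlgebra.ad K R[X] z) ^ (k + 1)) (C x)).coeff n ∈ D := by
  rw [pow_succ', Module.End.mul_apply, LieAlgebra.ad_apply, coeff_lie]
  refine D.sum_mem fun ij hij => ?_
  have hij := Finset.HasAntidiagonal.mem_antidiagonal.1 hij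
  exact hD _ (hz ij.1 (by omega)) _ (coeff_ad_pow_mem hx hz k ij.2 (by omega))

theorem C_mem_rees {F : ℕ → Submodule K R} {m : ℕ} {x : R} (hx : x ∈ F m) :
    C x ∈ reesFiltration F m := by
  intro n
  rw [coeff_C]
  split_ifs with hn
  · subst hn; simpa using hx
  · exact Submodule.zero_mem _

theorem C_mul_X_mem_rees {F : ℕ → Submodule K R} {x : R}
    (hx : x ∈ F 1) : C x * X ∈ reesFiltration F 1 := by
  intro n
  rw [coeff_C_mul, coeff_X]
  split_ifs with hn
  · subst hn; simpa using hx
  · simp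

/-- `exp (x X) * exp y = exp z` for a polynomial `z` which solves a differential equation. -/
theorem exists_polynomial_nilExp_eq [CharP K p] [Fact p.Prime] {L : LieSubalgebra K R}
    (hL : ∀ l : List R, (∀ x ∈ l, x ∈ L) → l.length = p → l.prod = 0) {x y : R}
    (hx : x ∈ L) (hy : y ∈ L) :
    ∃ z ∈ reesFiltration (productFiltration L) 1,
      nilExp K p z = nilExp K p (C x * X) * nilExp K p (C y) ∧
      ∃ b : K[X], b.coeff 0 = 1 ∧
        derivative z = aeval (LieAlgebra.ad K R[X] z) b (C x) := by
  have hp := (Fact.out : p.Prime).two_le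
  have hF := isNilFiltration_productFiltration hL
  have hG := hF.rees
  have hxX := C_mul_X_mem_rees (mem_productFiltration_one hx)
  have hyC := C_mem_rees (mem_productFiltration_one hy)
  have hdx : polyDerivative K R (C x * X) = C x := derivative_C_mul_X x
  have hdy : polyDerivative K R (C y) = 0 := derivative_C
  obtain ⟨z, hz, hzE⟩ := hG.exists_nilExp_eq hp
    (a := nilExp K p (C x * X) * nilExp K p (C y)) 
    (hG.mul_sub_one_mem (hG.nilExp_sub_one_mem hp hxX) (hG.nilExp_sub_one_mem hp hyC))
  have hz' := polyDerivative_mem_rees hF hz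
  have hode : polyDerivative K R (nilExp K p z) = C x * nilExp K p z := by
    rw [hzE, polyDerivative_mul, derivative_nilExp_of_commute hG hxX
        (by rw [hdx]; exact C_mem_rees (mem_productFiltration_one hx)),
      derivative_nilExp_of_commute hG hyC (by rw [hdy]; exact Submodule.zero_mem _), hdx, hdy]
    · simp [mul_assoc]
    · rw [hdy]; exact Commute.zero_right _
    · rw [hdx]; exact (Commute.refl _).mul_left (commute_X _)
  -- Cancelling the unit `exp z` leaves `((exp u - 1) / u) z' = x` with `u = ad z`; inverting the
  -- series solves for `z'`.
  rw [hG.derivation_nilExp _ polyDerivative_mul hz hz', ← aeval_expQuotient] at hode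
  have hphi := (hG.isUnit_nilExp hp hz).mul_right_cancel hode
  obtain ⟨b, hb0, hb⟩ := exists_expQuotient_inverse K hp
  refine ⟨z, hz, hzE, b, hb0, ?_⟩
  have hdz : polyDerivative K R z = aeval (LieAlgebra.ad K R[X] z) b (C x) := by
    rw [← hphi, aeval_expQuotient_inverse_apply hb]
    exact hG.eq_zero (by omega) (hG.ad_pow_mem hz hz' (p - 1))
  exact hdz

/-- Comparing coefficients of `X ^ n`. The constant term of `b` is split off because it is the only
one that contributes no bracket. -/
theorem smul_coeff_eq_of_derivative_eq {x : R} {z : R[X]} {b : K[X]} (hb0 : b.coeff 0 = 1)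
    (hdz : derivative z = aeval (LieAlgebra.ad K R[X] z) b (C x)) (n : ℕ) :
    ((n + 1 : ℕ) : K) • z.coeff (n + 1) = (∑ k ∈ Finset.range b.natDegree,
      b.coeff (k + 1) • ((LieAlgebra.ad K R[X] z ^ (k + 1)) (C x)).coeff n) +
        (C x).coeff n := by
  have hsum : aeval (LieAlgebra.ad K R[X] z) b (C x) = (∑ k ∈ Finset.range b.natDegree,
      b.coeff (k + 1) • (LieAlgebra.ad K R[X] z ^ (k + 1)) (C x)) + C x := by
    rw [aeval_eq_sum_range, LinearMap.sum_apply, Finset.sum_range_succ']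
    simp [hb0]
  have h1 : (derivative z).coeff n = ((n + 1 : ℕ) : K) • z.coeff (n + 1) := by
    rw [coeff_derivative, ← Nat.cast_succ, ← (Nat.cast_commute _ _).eq, ← nsmul_eq_mul,
      Nat.cast_smul_eq_nsmul]
  rw [← h1, hdz, hsum, coeff_add, finsetSum_coeff]
  simp only [coeff_smul]

/-- Evaluation of polynomials at a central element, as a homomorphism of `K`-algebras. -/
def aevalCentral (c : R) (hc : ∀ a : R, Commute a c) : R[X] →ₐ[K] R where
  toRingHom := eval₂RingHom' (RingHom.id R) c hc
  commutes' _ := eval_C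

@[simp]
theorem aevalCentral_apply (c : R) (hc : ∀ a : R, Commute a c) (f : R[X]) :
    aevalCentral (K := K) c hc f = f.eval c :=
  rfl

/-- The **Baker–Campbell–Hausdorff theorem**: `exp x * exp y = exp z` for some `z` in the Lie
algebra which is congruent to `x + y` modulo commutators. -/
theorem exists_nilExp_mul_nilExp [CharP K p] [Fact p.Prime] {L : LieSubalgebra K R}
    (hL : ∀ l : List R, (∀ x ∈ l, x ∈ L) → l.length = p → l.prod = 0) {D : Submodule K R}
    (hD : ∀ x ∈ L, ∀ y ∈ L, ⁅x, y⁆ ∈ D) {x y : R} (hx : x ∈ L) (hy : y ∈ L) :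
    ∃ z ∈ L, nilExp K p x * nilExp K p y = nilExp K p z ∧ z - (x + y) ∈ D := by
  have hp := (Fact.out : p.Prime).two_le
  obtain ⟨z, hz, hzE, b, hb0, hdz⟩ := exists_polynomial_nilExp_eq hL hx hy
  have hF := isNilFiltration_productFiltration hL
  have hcoeff := smul_coeff_eq_of_derivative_eq hb0 hdz
  have hbig : ∀ n, p ≤ n → z.coeff n = 0 := fun n hn =>
    hF.eq_zero (hn.trans (le_max_right _ _)) (hz n)
  have hcast : ∀ n, n + 1 < p → ((n + 1 : ℕ) : K) ≠ 0 := by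
    intro n hn h0
    rw [CharP.cast_eq_zero_iff K p] at h0
    exact absurd (Nat.le_of_dvd n.succ_pos h0) (by omega)
  -- At `X = 0` the equation reads `exp (z 0) = exp y`.
  have hz0 : z.coeff 0 = y := by
    refine hF.nilExp_injOn hp (by simpa using hz 0) (mem_productFiltration_one hy) ?_
    have h1 := congrArg (aevalCentral (K := K) 0 fun a => Commute.zero_right a) hzE
    rw [map_mul, map_nilExp, map_nilExp, map_nilExp] at h1
    simpa [coeff_zero_eq_eval_zero, nilExp_zero hp] using h1
  -- The recursion stays in `L` while `n + 1` is invertible; from degree `p` on the coefficients are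
  -- zero.
  have hzL : ∀ n, ∀ i ≤ n, z.coeff i ∈ L := by
    intro n
    induction n with
    | zero => intro i hi; rw [Nat.le_zero.1 hi, hz0]; exact hy
    | succ n ih =>
      intro i hi
      rcases Nat.le_succ_iff.1 hi with hi | rfl
      · exact ih i hi
      by_cases hn : n + 1 < p
      · rw [← L.mem_toSubmodule, ← L.toSubmodule.smul_mem_iff (hcast n hn), hcoeff]
        refine L.toSubmodule.add_mem (L.toSubmodule.sum_mem fun k _ => ?_) ?_
        · exact L.toSubmodule.smul_mem _ (coeff_ad_pow_mem hx ih (k + 1) n le_rfl)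
        · exact coeff_ad_pow_mem hx ih 0 n le_rfl
      · rw [hbig _ (not_lt.1 hn)]; exact L.zero_mem
  -- Modulo brackets the equation is `z' = x`, so `z` is `y + x X`.
  have hzD : ∀ n, z.coeff (n + 1) - (C x).coeff n ∈ D := by
    intro n
    by_cases hn : n + 1 < p
    · have h1 : ((n + 1 : ℕ) : K) • z.coeff (n + 1) - (C x).coeff n ∈ D := by
        rw [hcoeff, add_sub_cancel_right]
        exact D.sum_mem fun k _ => D.smul_mem _ (coeff_ad_pow_succ_mem hD hx (hzL n) k)
      cases n with
      | zero => simpa using h1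
      | succ n =>
        rw [coeff_C_succ, sub_zero] at h1 ⊢
        exact (D.smul_mem_iff (hcast _ hn)).1 h1
    · have hn0 : n ≠ 0 := by omega
      rw [hbig _ (not_lt.1 hn), coeff_C_of_ne_zero hn0, sub_zero]
      exact D.zero_mem
  refine ⟨z.eval 1, ?_, ?_, ?_⟩
  · rw [eval_eq_sum_range]
    simp only [one_pow, mul_one]
    exact L.toSubmodule.sum_mem fun i _ => hzL i i le_rfl
  · have h1 := congrArg (aevalCentral (K := K) 1 fun a => Commute.one_right a) hzE
    rw [map_mul, map_nilExp, map_nilExp, map_nilExp] at h1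
    rw [aevalCentral_apply, aevalCentral_apply, aevalCentral_apply, eval_mul_X, eval_C, eval_C,
      mul_one] at h1
    exact h1.symm
  -- The range is padded so that the terms of degree `0` and `1` can be split off even when `z` is
  -- constant.
  · rw [eval_eq_sum_range' (n := z.natDegree + 2) (by omega), Finset.sum_range_succ',
      Finset.sum_range_succ', hz0]
    simp only [one_pow, mul_one]
    have h0 := hzD 0
    rw [coeff_C_zero] at h0
    have h1 : ∑ k ∈ Finset.range z.natDegree, z.coeff (k + 1 + 1) ∈ D := by
      refine D.sum_mem fun k _ => ?_
      simpa using hzD (k + 1)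
    have := D.add_mem h1 h0
    convert this using 1
    abel

end BCH

/-! ### The exponential map of a nilpotent matrix Lie algebra -/

section ExpMap

variable {K : Type*} [Field K] {N p : ℕ} {𝔤 : LieSubalgebra K (Matrix (Fin N) (Fin N) K)}

theorem IsAdmissible.isNilFiltration (h : IsAdmissible p 𝔤) :
    IsNilFiltration p (productFiltration 𝔤) :=
  isNilFiltration_productFiltration h.prod_eq_zero

theorem expGroup_ext {g g' : expGroup p 𝔤}
    (hg : ((g : GL (Fin N) K) : Matrix (Fin N) (Fin N) K) = (g' : GL (Fin N) K)) : g = g' :=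
  Subtype.ext (Units.ext hg)

variable [CharP K p] [Fact p.Prime] (h : IsAdmissible p 𝔤)

theorem expMap_injective : Function.Injective (expMap h) := by
  intro x y hxy
  have hxy' := congrArg (fun g : expGroup p 𝔤 => ((g : GL (Fin N) K) : Matrix (Fin N) (Fin N) K)) hxy
  exact Subtype.ext (h.isNilFiltration.nilExp_injOn (Fact.out : p.Prime).two_le
    (mem_productFiltration_one x.2) (mem_productFiltration_one y.2) hxy')

/-- The Baker–Campbell–Hausdorff theorem for subalgebras of `𝔤`. -/
theorem exists_expMap_mul_expMap {𝔭 : LieSubalgebra K 𝔤} {D : Submodule K 𝔤}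
    (hD : ∀ x ∈ 𝔭, ∀ y ∈ 𝔭, ⁅x, y⁆ ∈ D) {x y : 𝔤} (hx : x ∈ 𝔭) (hy : y ∈ 𝔭) :
    ∃ z ∈ 𝔭, expMap h x * expMap h y = expMap h z ∧ z - (x + y) ∈ D := by
  have hmem : ∀ w ∈ 𝔭.map 𝔤.incl, w ∈ 𝔤 := by
    intro w hw
    obtain ⟨u, _, rfl⟩ := (LieSubalgebra.mem_map _ _ _).1 hw
    exact u.2
  obtain ⟨z, hz, hz1, hz2⟩ := exists_nilExp_mul_nilExp (p := p) (L := 𝔭.map 𝔤.incl)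
    (D := D.map 𝔤.toSubmodule.subtype)
    (fun l hl => h.prod_eq_zero l fun w hw => hmem w (hl w hw))
    (by
      intro a ha b hb
      obtain ⟨a', ha', rfl⟩ := (LieSubalgebra.mem_map _ _ _).1 ha
      obtain ⟨b', hb', rfl⟩ := (LieSubalgebra.mem_map _ _ _).1 hb
      exact ⟨⁅a', b'⁆, hD a' ha' b' hb', rfl⟩)
    (x := x) (y := y) ⟨x, hx, rfl⟩ ⟨y, hy, rfl⟩
  obtain ⟨z, hzp, rfl⟩ := (LieSubalgebra.mem_map _ _ _).1 hz
  refine ⟨z, hzp, expGroup_ext hz1, ?_⟩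
  obtain ⟨d, hd, hd'⟩ := hz2
  have : d = z - (x + y) := Subtype.ext hd'
  exact this ▸ hd

theorem expMap_zero : expMap h 0 = 1 :=
  expGroup_ext (nilExp_zero (Fact.out : p.Prime).two_le)

/-- The line through `x` is an abelian subalgebra, so Baker–Campbell–Hausdorff with `D = ⊥` makes
`exp` additive on it. -/
theorem expMap_neg (x : 𝔤) : expMap h (-x) = (expMap h x)⁻¹ := by
  have hlie : ∀ y ∈ Submodule.span K {x}, ∀ z ∈ Submodule.span K {x}, ⁅y, z⁆ = 0 := by
    intro y hy z hz
    obtain ⟨a, rfl⟩ := Submodule.mem_span_singleton.1 hy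
    obtain ⟨b, rfl⟩ := Submodule.mem_span_singleton.1 hz
    simp
  let 𝔭 : LieSubalgebra K 𝔤 :=
    { Submodule.span K {x} with
      lie_mem' := fun {y z} hy hz => by
        rw [hlie y hy z hz]; exact Submodule.zero_mem _ }
  have hx : x ∈ 𝔭 := Submodule.mem_span_singleton_self x
  obtain ⟨z, -, hz1, hz2⟩ := exists_expMap_mul_expMap h (𝔭 := 𝔭) (D := ⊥)
    (fun y hy z hz => (Submodule.mem_bot K).2 (hlie y hy z hz)) (neg_mem hx) hx
  rw [Submodule.mem_bot, neg_add_cancel, sub_zero] at hz2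
  rw [hz2, expMap_zero] at hz1
  exact eq_inv_of_mul_eq_one_left hz1

/-- By Baker–Campbell–Hausdorff the image of a subalgebra is already closed under products; the
congruence is not needed, hence `D = ⊤`. -/
theorem coe_expSubgroup (𝔭 : LieSubalgebra K 𝔤) :
    (expSubgroup h 𝔭 : Set (expGroup p 𝔤)) = expMap h '' (𝔭 : Set 𝔤) := by
  let S : Subgroup (expGroup p 𝔤) :=
    { carrier := expMap h '' (𝔭 : Set 𝔤)
      mul_mem' := by
        rintro _ _ ⟨x, hx, rfl⟩ ⟨y, hy, rfl⟩
        obtain ⟨z, hz, hz1, -⟩ := exists_expMap_mul_expMap h (D := ⊤)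
          (fun _ _ _ _ => Submodule.mem_top) hx hy
        exact ⟨z, hz, hz1.symm⟩
      one_mem' := ⟨0, 𝔭.zero_mem, expMap_zero h⟩
      inv_mem' := by
        rintro _ ⟨x, hx, rfl⟩
        exact ⟨-x, neg_mem (S := LieSubalgebra K 𝔤) hx, expMap_neg h x⟩ }
  have hS : expSubgroup h 𝔭 = S := Subgroup.closure_eq S
  rw [hS]
  rfl

theorem expMap_surjective : Function.Surjective (expMap h) := by
  rintro ⟨g, hg⟩
  have key : ∃ x : 𝔤, (expMap h x : GL (Fin N) K) = g := by
    rw [expGroup] at hg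
    induction hg using Subgroup.closure_induction with
    | mem u hu =>
      obtain ⟨x, hx, hux⟩ := hu
      exact ⟨⟨x, hx⟩, Units.ext hux.symm⟩
    | one => exact ⟨0, by rw [expMap_zero]; rfl⟩
    | mul u v _ _ hu hv =>
      obtain ⟨x, rfl⟩ := hu
      obtain ⟨y, rfl⟩ := hv
      obtain ⟨z, -, hz, -⟩ := exists_expMap_mul_expMap h (𝔭 := ⊤) (D := ⊤)
          (fun _ _ _ _ => Submodule.mem_top) (LieSubalgebra.mem_top x) (LieSubalgebra.mem_top y)
      exact ⟨z, by rw [← hz]; rfl⟩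
    | inv u _ hu =>
      obtain ⟨x, rfl⟩ := hu
      exact ⟨-x, by rw [expMap_neg]; rfl⟩
  obtain ⟨x, hx⟩ := key
  exact ⟨x, Subtype.ext hx⟩

theorem expMap_bijective : Function.Bijective (expMap h) :=
  ⟨expMap_injective h, expMap_surjective h⟩

/-- The exponential map as an equivalence. -/
def expEquiv : 𝔤 ≃ expGroup p 𝔤 :=
  Equiv.ofBijective _ (expMap_bijective h)

@[simp]
theorem expEquiv_apply (x : 𝔤) : expEquiv h x = expMap h x :=
  rfl

@[simp]
theorem expEquiv_symm_expMap (x : 𝔤) : (expEquiv h).symm (expMap h x) = x :=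
  (expEquiv h).symm_apply_apply x

theorem expMap_mem_expSubgroup_iff {𝔭 : LieSubalgebra K 𝔤} {x : 𝔤} :
    expMap h x ∈ expSubgroup h 𝔭 ↔ x ∈ 𝔭 := by
  rw [← SetLike.mem_coe, coe_expSubgroup, (expMap_injective h).mem_set_image]
  rfl

/-- Isotropy says that the brackets of `𝔭` lie in `ker lam`. With this kernel as `D`, the logarithm
of a product is the sum of the logarithms as far as `lam` can see. -/
theorem exists_isOrbitCharacter (ψ : AddChar K ℂ) {lam : Module.Dual K 𝔤} {𝔭 : LieSubalgebra K 𝔤}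
    (hiso : IsIsotropic lam 𝔭.toSubmodule) : ∃ χ, IsOrbitCharacter h ψ lam 𝔭 χ := by
  let f : expSubgroup h 𝔭 →* ℂ :=
    { toFun := fun u => ψ (lam ((expEquiv h).symm u))
      map_one' := by
        rw [Subgroup.coe_one, ← expMap_zero h, expEquiv_symm_expMap, map_zero,
          AddChar.map_zero_eq_one]
      map_mul' := by
        rintro ⟨u, hu⟩ ⟨v, hv⟩
        obtain ⟨x, rfl⟩ := expMap_surjective h u
        obtain ⟨y, rfl⟩ := expMap_surjective h v
        rw [expMap_mem_expSubgroup_iff] at hu hv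
        obtain ⟨z, -, hz, hz'⟩ := exists_expMap_mul_expMap h (D := LinearMap.ker lam)
          (fun a ha b hb => hiso a ha b hb) hu hv
        simp only [Subgroup.coe_mul, hz, expEquiv_symm_expMap]
        rw [LinearMap.mem_ker, map_sub, sub_eq_zero] at hz'
        rw [hz', map_add, AddChar.map_add_eq_mul] }
  refine ⟨f.toHomUnits, fun x hx => ?_⟩
  change ψ (lam ((expEquiv h).symm (expMap h x))) = _
  rw [expEquiv_symm_expMap]

theorem IsOrbitCharacter.unique {ψ : AddChar K ℂ} {lam : Module.Dual K 𝔤}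
    {𝔭 : LieSubalgebra K 𝔤} {χ χ' : expSubgroup h 𝔭 →* ℂˣ} (hχ : IsOrbitCharacter h ψ lam 𝔭 χ)
    (hχ' : IsOrbitCharacter h ψ lam 𝔭 χ') : χ = χ' := by
  refine MonoidHom.ext ?_
  rintro ⟨u, hu⟩
  obtain ⟨x, rfl⟩ := expMap_surjective h u
  have hx := (expMap_mem_expSubgroup_iff h).1 hu
  exact Units.ext ((hχ x hx).trans (hχ' x hx).symm)

theorem isOrbitCharacter_orbitCharacter (ψ : AddChar K ℂ) {lam : Module.Dual K 𝔤}
    {𝔭 : LieSubalgebra K 𝔤} (hiso : IsIsotropic lam 𝔭.toSubmodule) :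
    IsOrbitCharacter h ψ lam 𝔭 (orbitCharacter h ψ lam 𝔭) := by
  have hχ := exists_isOrbitCharacter h ψ hiso
  rw [orbitCharacter, dif_pos hχ]
  exact hχ.choose_spec

end ExpMap

/-! ### Existence and dimension of polarizations -/

section Polarization

variable {K L : Type*} [Field K] [LieRing L] [LieAlgebra K L]

@[simp]
theorem kirillovForm_apply (lam : Module.Dual K L) (x y : L) : kirillovForm lam x y = lam ⁅x, y⁆ :=
  rfl

theorem map_lie_skew (lam : Module.Dual K L) (x y : L) : lam ⁅x, y⁆ = -lam ⁅y, x⁆ := by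
  rw [← lie_skew, map_neg]

/-- Adjoining `x` to `𝔭` keeps it isotropic, so maximality applies. -/
theorem IsPolarization.mem {lam : Module.Dual K L} {𝔭 : LieSubalgebra K L}
    (h𝔭 : IsPolarization lam 𝔭) {x : L} (hx : ∀ y ∈ 𝔭, lam ⁅x, y⁆ = 0) : x ∈ 𝔭 := by
  have hle : 𝔭.toSubmodule ≤ 𝔭.toSubmodule ⊔ Submodule.span K {x} := le_sup_left
  refine h𝔭.2 ?_ hle
    (Submodule.mem_sup_right (Submodule.mem_span_singleton_self x))
  intro u hu v hv
  obtain ⟨a, ha, _, hc, rfl⟩ := Submodule.mem_sup.1 hu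
  obtain ⟨c, rfl⟩ := Submodule.mem_span_singleton.1 hc
  obtain ⟨b, hb, _, hd, rfl⟩ := Submodule.mem_sup.1 hv
  obtain ⟨d, rfl⟩ := Submodule.mem_span_singleton.1 hd
  have h1 : lam ⁅a, b⁆ = 0 := h𝔭.1 a ha b hb
  have h2 : lam ⁅a, x⁆ = 0 := by rw [map_lie_skew, hx a ha, neg_zero]
  simp [h1, h2, hx b hb]

theorem IsPolarization.stabilizer_le {lam : Module.Dual K L} {𝔭 : LieSubalgebra K L}
    (h𝔭 : IsPolarization lam 𝔭) : stabilizer lam ≤ 𝔭.toSubmodule := fun _ hx =>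
  h𝔭.mem fun y _ => LinearMap.congr_fun (LinearMap.mem_ker.1 hx) y

theorem mem_stabilizer {lam : Module.Dual K L} {x : L} :
    x ∈ stabilizer lam ↔ ∀ y, lam ⁅x, y⁆ = 0 :=
  LinearMap.ext_iff

/-- `𝔭` is its own orthogonal and contains the radical of the form, which is the stabilizer; the
claim is the dimension formula for orthogonals. -/
theorem IsPolarization.two_mul_finrank [FiniteDimensional K L] {lam : Module.Dual K L}
    {𝔭 : LieSubalgebra K L} (h𝔭 : IsPolarization lam 𝔭) :
    2 * Module.finrank K 𝔭.toSubmodule =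
      Module.finrank K L + Module.finrank K (stabilizer lam) := by
  have hB : LinearMap.BilinForm.IsRefl (kirillovForm lam) := by
    intro x y hxy
    rw [kirillovForm_apply] at hxy ⊢
    rw [map_lie_skew, hxy, neg_zero]
  have h1 := LinearMap.BilinForm.finrank_add_finrank_orthogonal hB 𝔭.toSubmodule
  have h2 : LinearMap.BilinForm.orthogonal (kirillovForm lam) 𝔭.toSubmodule = 𝔭.toSubmodule := by
    ext x
    rw [LinearMap.BilinForm.mem_orthogonal_iff]
    constructor
    · exact fun hx => h𝔭.mem fun y hy => hB _ _ (hx y hy)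
    · exact fun hx y hy => h𝔭.1 y hy x hx
  have h3 : LinearMap.BilinForm.orthogonal (kirillovForm lam) ⊤ = stabilizer lam := by
    ext x
    rw [LinearMap.BilinForm.mem_orthogonal_iff, mem_stabilizer]
    exact ⟨fun hx y => hB _ _ (hx y Submodule.mem_top), fun hx y _ => hB _ _ (hx y)⟩
  rw [h2, h3, inf_eq_right.2 h𝔭.stabilizer_le] at h1
  omega

/-- If `v` is orthogonal to the radical of the restriction of `B_lam` to `I`, then `B_lam(v, ·)`
and `B_lam(y, ·)` agree on `I` for some `y ∈ I`. -/
theorem exists_mem_lie_eq [FiniteDimensional K L] (lam : Module.Dual K L) (I : Submodule K L)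
    {v : L} (hv : ∀ r ∈ I, (∀ c ∈ I, lam ⁅r, c⁆ = 0) → lam ⁅v, r⁆ = 0) :
    ∃ y ∈ I, ∀ c ∈ I, lam ⁅v, c⁆ = lam ⁅y, c⁆ := by
  let B : I →ₗ[K] Module.Dual K I := (kirillovForm lam).domRestrict₁₂ I I
  have h1 : ((kirillovForm lam v).comp I.subtype : Module.Dual K I) ∈ LinearMap.range B := by
    -- The range of `B` is the annihilator of its coannihilator, and the latter is the radical of
    -- the restricted form.
    rw [← Subspace.dualCoannihilator_dualAnnihilator_eq (W := LinearMap.range B),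
      Submodule.mem_dualAnnihilator]
    intro r hr
    rw [Submodule.mem_dualCoannihilator] at hr
    refine hv r r.2 fun c hc => ?_
    rw [map_lie_skew, neg_eq_zero]
    exact hr (B ⟨c, hc⟩) ⟨_, rfl⟩
  obtain ⟨y, hy⟩ := h1
  exact ⟨y, y.2, fun c hc => (LinearMap.congr_fun hy ⟨c, hc⟩).symm⟩

/-- A subspace `P` of an ideal `I` which is a polarization of the restriction of `lam` to `I` and
is normalized by the orthogonal complement of `I`. -/
structure IsRelativePolarization (lam : Module.Dual K L) (I P : Submodule K L) : Prop where
  lie_mem : ∀ y : L, ∀ x ∈ I, ⁅y, x⁆ ∈ I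
  le : P ≤ I
  isotropic : ∀ a ∈ P, ∀ b ∈ P, lam ⁅a, b⁆ = 0
  mem : ∀ x ∈ I, (∀ a ∈ P, lam ⁅x, a⁆ = 0) → x ∈ P
  lie_mem_of_orthogonal : ∀ b : L, (∀ c ∈ I, lam ⁅b, c⁆ = 0) → ∀ a ∈ P, ⁅b, a⁆ ∈ P
  lie_mem_self : ∀ a ∈ P, ∀ b ∈ P, ⁅a, b⁆ ∈ P

theorem isRelativePolarization_bot (lam : Module.Dual K L) : IsRelativePolarization lam ⊥ ⊥ := by
  constructor <;> simp

/-- The new subspace is `P + R`, with `R` the radical of the form on `J = I + K x`. As `R` is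
orthogonal to `I`, it normalizes `P`; by the Jacobi identity the orthogonal of `J`, which contains
`R`, normalizes `R`. So `P + R` is a subalgebra, normalized by the orthogonal of `J`. -/
theorem IsRelativePolarization.exists_sup_span [FiniteDimensional K L] {lam : Module.Dual K L}
    {I P : Submodule K L} (h : IsRelativePolarization lam I P) {x : L} (hx : ∀ y : L, ⁅y, x⁆ ∈ I) :
    ∃ P', IsRelativePolarization lam (I ⊔ Submodule.span K {x}) P' := by
  set J := I ⊔ Submodule.span K {x}
  have hIJ : I ≤ J := le_sup_left
  have hxJ : x ∈ J := Submodule.mem_sup_right (Submodule.mem_span_singleton_self x)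
  have hJmem : ∀ v ∈ J, ∃ i ∈ I, ∃ c : K, v = i + c • x := by
    intro v hv
    obtain ⟨i, hi, _, hc, rfl⟩ := Submodule.mem_sup.1 hv
    obtain ⟨c, rfl⟩ := Submodule.mem_span_singleton.1 hc
    exact ⟨i, hi, c, rfl⟩
  have hJ : ∀ y : L, ∀ v ∈ J, ⁅y, v⁆ ∈ J := by
    intro y v hv
    obtain ⟨i, hi, c, rfl⟩ := hJmem v hv
    rw [lie_add, lie_smul]
    exact hIJ (I.add_mem (h.lie_mem y i hi) (I.smul_mem c (hx y)))
  let R : Submodule K L :=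
    { carrier := {b | b ∈ J ∧ ∀ c ∈ J, lam ⁅b, c⁆ = 0}
      add_mem' := fun {a b} ha hb => ⟨J.add_mem ha.1 hb.1, fun c hc => by
        rw [add_lie, map_add, ha.2 c hc, hb.2 c hc, add_zero]⟩
      zero_mem' := ⟨J.zero_mem, fun c _ => by simp⟩
      smul_mem' := fun k a ha => ⟨J.smul_mem k ha.1, fun c hc => by
        rw [smul_lie, map_smul, ha.2 c hc, smul_zero]⟩ }
  have hR : ∀ b : L, (∀ c ∈ J, lam ⁅b, c⁆ = 0) → ∀ r ∈ R, ⁅b, r⁆ ∈ R := by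
    intro b hb r hr
    refine ⟨hJ b r hr.1, fun c hc => ?_⟩
    rw [lie_lie, map_sub, hb _ (hJ r c hc), hr.2 _ (hJ b c hc), sub_zero]
  have hPJ : P ≤ J := h.le.trans hIJ
  refine ⟨P ⊔ R, hJ, sup_le hPJ fun r hr => hr.1, ?_, ?_, ?_, ?_⟩
  · intro u hu v hv
    obtain ⟨a, ha, r, hr, rfl⟩ := Submodule.mem_sup.1 hu
    obtain ⟨b, hb, s, hs, rfl⟩ := Submodule.mem_sup.1 hv
    rw [lie_add, add_lie, add_lie, map_add, map_add, map_add, h.isotropic a ha b hb,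
      hr.2 b (hPJ hb), hr.2 s hs.1, map_lie_skew, hs.2 a (hPJ ha)]
    simp
  · intro v hv hvP
    have hvI : ∀ a ∈ P, lam ⁅v, a⁆ = 0 := fun a ha => hvP a (Submodule.mem_sup_left ha)
    obtain ⟨i, hi, c, hvi⟩ := hJmem v hv
    by_cases hc : c = 0
    · rw [hc, zero_smul, add_zero] at hvi
      exact Submodule.mem_sup_left (h.mem v (hvi ▸ hi) hvI)
    -- The radical of the form on `I` lies in `P`, to which `v` is orthogonal. So some `y ∈ I`
    -- represents `v` on `I`; then `y ∈ P`, and `v - y` is orthogonal to `I` and to `v`, hence to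
    -- `x`, so it lies in `R`.
    obtain ⟨y, hy, hvy⟩ := exists_mem_lie_eq lam I (v := v) fun r hr hr' =>
      hvI r (h.mem r hr fun a ha => hr' a (h.le ha))
    have h1 : ∀ d ∈ I, lam ⁅v - y, d⁆ = 0 := fun d hd => by
      rw [sub_lie, map_sub, hvy d hd, sub_self]
    have h2 : lam ⁅v - y, v⁆ = 0 := by
      rw [sub_lie, lie_self, zero_sub, map_neg, ← map_lie_skew, hvy y hy, lie_self, map_zero]
    have h3 : lam ⁅v - y, x⁆ = 0 := by
      have h4 : c • lam ⁅v - y, x⁆ = 0 := by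
        rw [← map_smul, ← lie_smul, show c • x = v - i by rw [hvi]; abel, lie_sub, map_sub, h2,
          h1 i hi, sub_zero]
      exact (smul_eq_zero.1 h4).resolve_left hc
    have h4 : v - y ∈ R := by
      refine ⟨J.sub_mem hv (hIJ hy), fun d hd => ?_⟩
      obtain ⟨j, hj, e, rfl⟩ := hJmem d hd
      rw [lie_add, lie_smul, map_add, map_smul, h1 j hj, h3, smul_zero, add_zero]
    have h5 : y ∈ P := by
      refine h.mem y hy fun a ha => ?_
      rw [← hvy a (h.le ha), hvI a ha]
    rw [← add_sub_cancel y v]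
    exact Submodule.add_mem_sup h5 h4
  · intro b hb u hu
    obtain ⟨a, ha, r, hr, rfl⟩ := Submodule.mem_sup.1 hu
    rw [lie_add]
    exact Submodule.add_mem_sup (h.lie_mem_of_orthogonal b (fun c hc => hb c (hIJ hc)) a ha)
      (hR b hb r hr)
  · intro u hu v hv
    obtain ⟨a, ha, r, hr, rfl⟩ := Submodule.mem_sup.1 hu
    obtain ⟨b, hb, s, hs, rfl⟩ := Submodule.mem_sup.1 hv
    have h1 : ∀ t ∈ R, ∀ d ∈ P, ⁅t, d⁆ ∈ P := fun t ht d hd =>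
      h.lie_mem_of_orthogonal t (fun c hc => ht.2 c (hIJ hc)) d hd
    have h2 : ⁅a, s⁆ ∈ P := by
      rw [← lie_skew]
      exact P.neg_mem (h1 s hs a ha)
    rw [add_lie, lie_add, lie_add, ← add_assoc]
    exact Submodule.add_mem_sup
      (P.add_mem (P.add_mem (h.lie_mem_self a ha b hb) h2) (h1 r hr b hb)) (hR r hr.2 s hs)

/-- Every linear form on a nilpotent Lie algebra has a polarization. -/
theorem exists_isPolarization [FiniteDimensional K L]
    (hL : ∀ I : Submodule K L, I ≠ ⊤ → ∃ x ∉ I, ∀ y : L, ⁅y, x⁆ ∈ I) (lam : Module.Dual K L) :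
    ∃ 𝔭 : LieSubalgebra K L, IsPolarization lam 𝔭 := by
  -- A maximal ideal that has a relative polarization must be everything, since otherwise it could
  -- be enlarged by one dimension.
  obtain ⟨I, ⟨P, hP⟩, hmax⟩ := WellFounded.has_min
    (wellFounded_gt (α := Submodule K L)) {I | ∃ P, IsRelativePolarization lam I P}
    ⟨⊥, ⊥, isRelativePolarization_bot lam⟩
  obtain rfl : I = ⊤ := by
    by_contra hI
    obtain ⟨x, hxI, hx⟩ := hL I hI
    refine hmax _ (hP.exists_sup_span hx) (lt_of_le_of_ne le_sup_left fun he => hxI ?_)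
    rw [he]
    exact Submodule.mem_sup_right (Submodule.mem_span_singleton_self x)
  refine ⟨{ P with lie_mem' := fun {a b} ha hb => hP.lie_mem_self a ha b hb }, ?_, ?_⟩
  · exact hP.isotropic
  · intro W hW hPW w hw
    exact hP.mem w Submodule.mem_top fun a ha => hW w hw a (hPW ha)

end Polarization

/-- If the enlargement step failed at `I`, bracketing an element outside `I` could be repeated
forever without entering `I`, while the products reach filtration degree `p`, where only `0 ∈ I`
remains. -/
theorem IsAdmissible.exists_isPolarization {K : Type*} [Field K] {N p : ℕ}
    {𝔤 : LieSubalgebra K (Matrix (Fin N) (Fin N) K)} (h : IsAdmissible p 𝔤)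
    (lam : Module.Dual K 𝔤) : ∃ 𝔭 : LieSubalgebra K 𝔤, IsPolarization lam 𝔭 := by
  have : FiniteDimensional K 𝔤 := inferInstanceAs (FiniteDimensional K 𝔤.toSubmodule)
  refine OrbitMethod.exists_isPolarization (fun I hI => ?_) lam
  by_contra! hcon
  have hF := h.isNilFiltration
  have key : ∀ n, ∃ x : 𝔤, x ∉ I ∧ (x : Matrix (Fin N) (Fin N) K) ∈ productFiltration 𝔤 (n + 1) := by
    intro n
    induction n with
    | zero =>
      obtain ⟨x, -, hx⟩ := SetLike.exists_of_lt (lt_top_iff_ne_top.2 hI)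
      exact ⟨x, hx, mem_productFiltration_one x.2⟩
    | succ n ih =>
      obtain ⟨x, hxI, hx⟩ := ih
      obtain ⟨y, hy⟩ := hcon x hxI
      refine ⟨_, hy, ?_⟩
      have hy1 := mem_productFiltration_one y.2
      have h1 := hF.mul_mem hy1 hx
      have h2 := hF.mul_mem hx hy1
      rw [show 1 + (n + 1) = n + 1 + 1 by ring] at h1
      exact Submodule.sub_mem _ h1 h2
  obtain ⟨x, hxI, hx⟩ := key p
  have hx0 : x = 0 := Subtype.ext (hF.eq_zero p.le_succ hx)
  exact hxI (hx0 ▸ I.zero_mem)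

/-! ### The character of an induced representation -/

section Induced

open Representation

theorem finite_monoidAlgebra (k G : Type*) [CommSemiring k] [Finite G] :
    Module.Finite k (MonoidAlgebra k G) :=
  Module.Finite.of_basis (MonoidAlgebra.basis G k)

theorem finite_indV {G A : Type*} [Group G] [Finite G] [AddCommGroup A] [Module ℂ A]
    [Module.Finite ℂ A] (P : Subgroup G) (ρ : Representation ℂ P A) :
    Module.Finite ℂ (IndV P.subtype ρ) := by
  have := finite_monoidAlgebra ℂ G
  infer_instance

theorem trace_charRep {P : Type*} [Group P] (χ : P →* ℂˣ) (u : P) :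
    LinearMap.trace ℂ ℂ (charRep χ u) = χ u := by
  have : charRep χ u = LinearMap.smulRight (LinearMap.id : ℂ →ₗ[ℂ] ℂ) (χ u : ℂ) := by
    ext
    simp [charRep]
  rw [this, LinearMap.trace_smulRight, LinearMap.id_apply]

theorem trace_of_apply_single {G : Type*} [Fintype G] [DecidableEq G]
    (f : Module.End ℂ (MonoidAlgebra ℂ G)) (e : G → G)
    (hf : ∀ x, f (MonoidAlgebra.single x 1) = MonoidAlgebra.single (e x) 1) :
    LinearMap.trace ℂ _ f = ∑ x, if e x = x then 1 else 0 := by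
  rw [LinearMap.trace_eq_matrix_trace ℂ (MonoidAlgebra.basis G ℂ), Matrix.trace]
  refine Finset.sum_congr rfl fun x _ => ?_
  rw [Matrix.diag_apply, LinearMap.toMatrix_apply]
  simp [MonoidAlgebra.basis, hf, Finsupp.single_apply]

/-- Averaging over `P` factors through the coinvariants and gives a section `s` of the projection;
cyclicity of the trace moves the computation up to `V`. -/
theorem trace_eq_average {P V : Type*} [Group P] [Fintype P] [AddCommGroup V] [Module ℂ V]
    [Module.Finite ℂ V] (σ : Representation ℂ P V) (T : Module.End ℂ V)
    (S : Module.End ℂ (Coinvariants σ)) (hTS : S ∘ₗ Coinvariants.mk σ = Coinvariants.mk σ ∘ₗ T) :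
    LinearMap.trace ℂ _ S = (Nat.card P : ℂ)⁻¹ * ∑ u : P, LinearMap.trace ℂ V (σ u ∘ₗ T) := by
  have hcard : (Nat.card P : ℂ) ≠ 0 := Nat.cast_ne_zero.2 Nat.card_pos.ne'
  let avg : Module.End ℂ V := (Nat.card P : ℂ)⁻¹ • ∑ u : P, σ u
  have havg : ∀ g, avg ∘ₗ σ g = avg := by
    intro g
    change avg * σ g = avg
    simp only [avg]
    rw [smul_mul_assoc, Finset.sum_mul]
    congr 1
    simp_rw [← map_mul]
    exact Fintype.sum_equiv (Equiv.mulRight g) _ _ fun _ => rfl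
  let s := Coinvariants.lift σ avg havg
  have hs : Coinvariants.mk σ ∘ₗ s = LinearMap.id := by
    refine Coinvariants.hom_ext (LinearMap.ext fun v => ?_)
    simp only [LinearMap.comp_apply, s, Coinvariants.lift_mk, LinearMap.id_apply, avg,
      LinearMap.smul_apply, LinearMap.sum_apply, map_smul, map_sum, Coinvariants.mk_self_apply,
      Finset.sum_const, Finset.card_univ, ← Nat.card_eq_fintype_card]
    rw [← Nat.cast_smul_eq_nsmul ℂ, smul_smul, inv_mul_cancel₀ hcard, one_smul]
  calc LinearMap.trace ℂ _ S = LinearMap.trace ℂ _ ((S ∘ₗ Coinvariants.mk σ) ∘ₗ s) := by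
        rw [LinearMap.comp_assoc, hs, LinearMap.comp_id]
    _ = LinearMap.trace ℂ V ((s ∘ₗ Coinvariants.mk σ) ∘ₗ T) := by
        rw [LinearMap.trace_comp_comm', hTS, LinearMap.comp_assoc]
    _ = LinearMap.trace ℂ V (avg ∘ₗ T) := rfl
    _ = _ := by
        change LinearMap.trace ℂ V (avg * T) = _ * ∑ u : P, LinearMap.trace ℂ V (σ u * T)
        simp only [avg]
        rw [smul_mul_assoc, Finset.sum_mul, map_smul, map_sum, smul_eq_mul]

/-- The formula for the character of the representation induced from a one-dimensional
representation. -/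
theorem character_ind_charRep {G : Type*} [Group G] [Fintype G] (P : Subgroup G) (χ : P →* ℂˣ)
    {f : G → ℂ} (hfP : ∀ u : P, f u = χ u) (hf : ∀ g ∉ P, f g = 0) (g : G) :
    (ind P.subtype (charRep χ)).character g =
      (Nat.card P : ℂ)⁻¹ * ∑ s, f (s * g * s⁻¹) := by
  classical
  have := Fintype.ofFinite P
  have := finite_monoidAlgebra ℂ G
  rw [character, trace_eq_average _
    ((MonoidAlgebra.mapDomainLinearMap ℂ ℂ fun x => x * g⁻¹).rTensor ℂ) _ rfl]
  congr 1
  -- Before coinvariants are taken, `u` combined with `g` permutes the basis by `s ↦ u s g⁻¹` up to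
  -- the scalar `χ u`. A fixed point `s` means `s g s⁻¹ = u`, so each `s` counts for at most one
  -- `u`.
  have h1 : ∀ u : P, LinearMap.trace ℂ _
      (Representation.tprod ((leftRegular ℂ G).comp P.subtype) (charRep χ) u ∘ₗ
        (MonoidAlgebra.mapDomainLinearMap ℂ ℂ fun x => x * g⁻¹).rTensor ℂ) =
      ∑ s : G, if s * g * s⁻¹ = u then f (s * g * s⁻¹) else 0 := by
    intro u
    have h2 : Representation.tprod ((leftRegular ℂ G).comp P.subtype) (charRep χ) u ∘ₗ
        (MonoidAlgebra.mapDomainLinearMap ℂ ℂ fun x => x * g⁻¹).rTensor ℂ =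
        TensorProduct.map (leftRegular ℂ G u ∘ₗ
          MonoidAlgebra.mapDomainLinearMap ℂ ℂ fun x => x * g⁻¹) (charRep χ u) := by
      ext
      simp
    rw [h2, LinearMap.trace_tensorProduct', trace_charRep,
      trace_of_apply_single _ (fun x => u * (x * g⁻¹)) (fun x => by simp), Finset.sum_mul]
    refine Finset.sum_congr rfl fun s _ => ?_
    have h3 : (u : G) * (s * g⁻¹) = s ↔ s * g * s⁻¹ = u := by
      rw [← mul_assoc, mul_inv_eq_iff_eq_mul, mul_inv_eq_iff_eq_mul]
      exact eq_comm
    rw [if_congr h3 rfl rfl]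
    split_ifs with hu
    · rw [hu, hfP, one_mul]
    · rw [zero_mul]
  rw [Finset.sum_congr rfl fun u _ => h1 u, Finset.sum_comm]
  refine Finset.sum_congr rfl fun s _ => ?_
  by_cases hs : s * g * s⁻¹ ∈ P
  · rw [Finset.sum_eq_single ⟨_, hs⟩ (fun u _ hu => if_neg fun h => hu (Subtype.ext h.symm))
      (fun h => absurd (Finset.mem_univ _) h), if_pos rfl]
  · rw [hf _ hs]
    exact Finset.sum_eq_zero fun u _ => if_neg fun h => hs (by rw [h]; exact u.2)

end Induced

/-! ### Stabilizers and orbits of the coadjoint action -/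

section Coadjoint

variable {K : Type*} [Field K] {N p : ℕ} {𝔤 : LieSubalgebra K (Matrix (Fin N) (Fin N) K)}

theorem coe_ad_pow (x y : 𝔤) (i : ℕ) : (((LieAlgebra.ad K 𝔤 x) ^ i) y : Matrix (Fin N) (Fin N) K) =
    ((LieAlgebra.ad K (Matrix (Fin N) (Fin N) K) x) ^ i) y := by
  induction i with
  | zero => rfl
  | succ i ih =>
    rw [pow_succ', pow_succ', Module.End.mul_apply, Module.End.mul_apply, ← ih]
    rfl

/-- The exponent is `p - 1` because the element acted upon is itself the `p`-th factor. This matches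
the precision to which `expQuotient` was inverted. -/
theorem IsAdmissible.ad_pow_eq_zero (h : IsAdmissible p 𝔤) (x : 𝔤) :
    (LieAlgebra.ad K 𝔤 x) ^ (p - 1) = 0 := by
  refine LinearMap.ext fun y => Subtype.ext ?_
  rw [coe_ad_pow]
  exact h.isNilFiltration.eq_zero (by omega) (h.isNilFiltration.ad_pow_mem
    (mem_productFiltration_one x.2) (mem_productFiltration_one y.2) (p - 1))

variable [CharP K p] [Fact p.Prime] (h : IsAdmissible p 𝔤)

-- This is `exp u = 1 + u ((exp u - 1) / u)` at `u = ad x`; the bracket is pulled out so that `lam`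
-- can be tested against it.
open Polynomial in
theorem Ad_expMap (x y : 𝔤) : Ad h (expMap h x) y =
    ⁅x, aeval (LieAlgebra.ad K 𝔤 x) (expQuotient K p) y⁆ + y := by
  have hp := (Fact.out : p.Prime).pos
  have h1 : Ad h (expMap h x) y = ∑ i ∈ Finset.range p,
      ((i ! : K)⁻¹) • ((LieAlgebra.ad K 𝔤 x) ^ i) y := by
    refine Subtype.ext ?_
    have h2 : ((Ad h (expMap h x) y : 𝔤) : Matrix (Fin N) (Fin N) K) =
        texp p (x : Matrix (Fin N) (Fin N) K) * y *
          ((expMap h x : GL (Fin N) K)⁻¹ : GL (Fin N) K) := rfl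
    rw [h2, texp_mul h x.2 y.2]
    have h3 : texp p (x : Matrix (Fin N) (Fin N) K) =
      ((expMap h x : GL (Fin N) K) : Matrix (Fin N) (Fin N) K) := rfl
    rw [h3, Units.mul_inv_cancel_right, AddSubmonoidClass.coe_finsetSum]
    refine Finset.sum_congr rfl fun i _ => ?_
    rw [← coe_ad_pow]
    rfl
  obtain ⟨m, hm⟩ : ∃ m, p = m + 1 := ⟨p - 1, by omega⟩
  rw [h1, aeval_expQuotient, show p - 1 = m by omega]
  conv_lhs => rw [hm]
  rw [Finset.sum_range_succ', ← LieAlgebra.ad_apply K, map_sum]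
  congr 1
  · refine Finset.sum_congr rfl fun k _ => ?_
    rw [map_smul, pow_succ', Module.End.mul_apply]
  · simp

theorem coAd_apply (g : expGroup p 𝔤) (lam : Module.Dual K 𝔤) (y : 𝔤) :
    coAd h g lam y = lam (Ad h g⁻¹ y) :=
  rfl

theorem coAd_expMap_apply (x : 𝔤) (lam : Module.Dual K 𝔤) (y : 𝔤) :
    coAd h (expMap h x) lam y = lam (Ad h (expMap h (-x)) y) := by
  rw [coAd_apply, expMap_neg]

-- The operator `(exp u - 1) / u` at `u = ad (-x)` is invertible, so its values exhaust `𝔤` and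
-- `lam` must vanish on every bracket with `x`.
open Polynomial in
theorem coAd_expMap_eq_self_iff {lam : Module.Dual K 𝔤} {x : 𝔤} :
    coAd h (expMap h x) lam = lam ↔ x ∈ stabilizer lam := by
  have h1 : coAd h (expMap h x) lam = lam ↔ ∀ y, lam ⁅-x,
      aeval (LieAlgebra.ad K 𝔤 (-x)) (expQuotient K p) y⁆ = 0 := by
    rw [LinearMap.ext_iff]
    refine forall_congr' fun y => ?_
    rw [coAd_expMap_apply, Ad_expMap, map_add, add_eq_right]
  rw [h1, mem_stabilizer]
  constructor
  · intro hx w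
    obtain ⟨b, -, hb⟩ := exists_expQuotient_inverse K (Fact.out : p.Prime).two_le
    have h2 := aeval_expQuotient_inverse_apply hb (A := LieAlgebra.ad K 𝔤 (-x)) (w := w)
      (by rw [h.ad_pow_eq_zero]; rfl)
    rw [← Module.End.mul_apply, ← map_mul, mul_comm, map_mul, Module.End.mul_apply] at h2
    have h3 := hx (aeval (LieAlgebra.ad K 𝔤 (-x)) b w)
    rwa [h2, neg_lie, map_neg, neg_eq_zero] at h3
  · intro hx y
    rw [neg_lie, map_neg, hx, neg_zero]

theorem coAd_expMap_apply_of_mem {lam : Module.Dual K 𝔤} {𝔭 : LieSubalgebra K 𝔤}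
    (h𝔭 : IsIsotropic lam 𝔭.toSubmodule) {x y : 𝔤} (hx : x ∈ 𝔭) (hy : y ∈ 𝔭) :
    coAd h (expMap h x) lam y = lam y := by
  have hx' : -x ∈ 𝔭 := neg_mem hx
  have h1 : ∀ k, ((LieAlgebra.ad K 𝔤 (-x)) ^ k) y ∈ 𝔭 := by
    intro k
    induction k with
    | zero => exact hy
    | succ k ih =>
      rw [pow_succ', Module.End.mul_apply, LieAlgebra.ad_apply]
      exact 𝔭.lie_mem hx' ih
  rw [coAd_expMap_apply, Ad_expMap, map_add, aeval_expQuotient, add_eq_right]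
  exact h𝔭 _ hx' _ (𝔭.toSubmodule.sum_mem fun k _ => 𝔭.toSubmodule.smul_mem _ (h1 k))

theorem conj_expMap (g : expGroup p 𝔤) (x : 𝔤) :
    g * expMap h x * g⁻¹ = expMap h (Ad h g x) := by
  refine expGroup_ext ?_
  obtain ⟨g, hg⟩ := g
  change (g : Matrix (Fin N) (Fin N) K) * texp p (x : Matrix (Fin N) (Fin N) K) *
    ((g⁻¹ : GL (Fin N) K) : Matrix (Fin N) (Fin N) K) =
      texp p ((g : Matrix (Fin N) (Fin N) K) * (x : Matrix (Fin N) (Fin N) K) *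
        ((g⁻¹ : GL (Fin N) K) : Matrix (Fin N) (Fin N) K))
  rw [texp, texp, Finset.mul_sum, Finset.sum_mul]
  refine Finset.sum_congr rfl fun k _ => ?_
  rw [Units.conj_pow, mul_smul_comm, smul_mul_assoc]

end Coadjoint

/-! ### Sums over orbits and character sums -/

section Sums

variable {K V H : Type*} [Field K] [AddCommGroup V] [Module K V] [Group H]

/-- The fibre of the orbit map through `u` is the left coset of the stabilizer that contains `u`. -/
theorem card_filter_apply_eq [Fintype H] (ρ : Representation K H V) (v : V) (u : H)
    [DecidablePred fun t => ρ t v = ρ u v] : (Finset.univ.filter fun t : H => ρ t v = ρ u v).card =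
      Nat.card {t : H // ρ t v = v} := by
  rw [← Fintype.card_subtype, ← Nat.card_eq_fintype_card]
  refine Nat.card_congr ((Equiv.mulLeft u⁻¹).subtypeEquiv fun t => ?_)
  change _ ↔ ρ (u⁻¹ * t) v = v
  rw [map_mul, Module.End.mul_apply]
  constructor
  · intro ht
    rw [ht, Representation.inv_self_apply]
  · intro ht
    rw [← ht, Representation.self_inv_apply, ht]

theorem sum_apply_eq_card_mul_sum [Fintype H] [DecidableEq V] (ρ : Representation K H V) (v : V)
    (Φ : V → ℂ) : ∑ u, Φ (ρ u v) = (Nat.card {t : H // ρ t v = v} : ℂ) *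
      ∑ w ∈ Finset.univ.image fun u => ρ u v, Φ w := by
  rw [Finset.mul_sum, Finset.sum_comp Φ fun u => ρ u v]
  refine Finset.sum_congr rfl fun w hw => ?_
  obtain ⟨u, -, rfl⟩ := Finset.mem_image.1 hw
  rw [card_filter_apply_eq, nsmul_eq_mul]

theorem card_eq_card_mul_card_image [Fintype H] [DecidableEq V] (ρ : Representation K H V) (v : V) :
    Nat.card H = Nat.card {t : H // ρ t v = v} *
      (Finset.univ.image fun u => ρ u v).card := by
  have h := sum_apply_eq_card_mul_sum ρ v 1
  simp only [Pi.one_apply, Finset.sum_const, Finset.card_univ, nsmul_one] at h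
  rw [Nat.card_eq_fintype_card]
  exact_mod_cast h

/-- Meant for orbit sums of additive characters of `𝔤`: orthogonality turns their inner product into
a count of coincidences. -/
theorem sum_mul_sum_eq_card {A B X : Type*} [Fintype A] [Fintype B] [Fintype X] {f : A → X → ℂ}
    {g : B → X → ℂ} {r : A → B → Prop} [∀ a b, Decidable (r a b)] {c : ℂ}
    (hfg : ∀ a b, ∑ x, f a x * g b x = if r a b then c else 0) :
    ∑ x, (∑ a, f a x) * ∑ b, g b x =
      c * ∑ b, ((Finset.univ.filter fun a => r a b).card : ℂ) := by
  calc ∑ x, (∑ a, f a x) * ∑ b, g b x = ∑ x, ∑ b, ∑ a, f a x * g b x := by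
        refine Finset.sum_congr rfl fun x _ => ?_
        rw [Finset.sum_mul_sum, Finset.sum_comm]
    _ = ∑ b, ∑ a, ∑ x, f a x * g b x := by
        rw [Finset.sum_comm]
        exact Finset.sum_congr rfl fun b _ => Finset.sum_comm
    _ = _ := by
        rw [Finset.mul_sum]
        refine Finset.sum_congr rfl fun b _ => ?_
        simp_rw [hfg]
        rw [← Finset.sum_filter, Finset.sum_const, nsmul_eq_mul, mul_comm]

theorem sum_addChar_apply [Fintype V] {ψ : AddChar K ℂ} (hψ : ψ ≠ 1) (l : Module.Dual K V)
    [Decidable (l = 0)] :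
    ∑ x, ψ (l x) = if l = 0 then (Nat.card V : ℂ) else 0 := by
  split_ifs with hl
  · simp [hl]
  · obtain ⟨v, hv⟩ : ∃ v, l v ≠ 0 := by
      by_contra! hcon
      exact hl (LinearMap.ext hcon)
    refine AddChar.sum_eq_zero_of_ne_one (ψ := ψ.compAddMonoidHom l.toAddMonoidHom) ?_
    intro h1
    refine hψ (DFunLike.ext _ _ fun c => ?_)
    -- A nonzero form is onto `K`; this vector is sent to `c`.
    have h2 := DFunLike.congr_fun h1 ((c / l v) • v)
    simpa [hv] using h2

end Sums

/-! ### Irreducibility criteria -/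

section Irreducible

open Representation

variable {G V W : Type*} [Group G] [Finite G] [AddCommGroup V] [Module ℂ V] [AddCommGroup W]
  [Module ℂ W] {ρ : Representation ℂ G V} {σ : Representation ℂ G W}

theorem finiteDimensional_of_isIrreducible (hρ : ρ.IsIrreducible) : FiniteDimensional ℂ V := by
  have := finite_monoidAlgebra ℂ G
  have h1 : Module.Finite (MonoidAlgebra ℂ G) ρ.asModule := inferInstance
  exact Module.Finite.trans (R := ℂ) (MonoidAlgebra ℂ G) ρ.asModule

/-- By Maschke a subrepresentation is the image of an equivariant projection, which here is a
scalar; it is zero or everything according to that scalar. -/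
theorem isIrreducible_of_finrank_intertwiningMap
    (hρ : Module.finrank ℂ (IntertwiningMap ρ ρ) = 1) : ρ.IsIrreducible := by
  have hend : ∀ e : Module.End (MonoidAlgebra ℂ G) ρ.asModule, ∃ c : ℂ, c • 1 = e := by
    have h1 : Module.finrank ℂ (Module.End (MonoidAlgebra ℂ G) ρ.asModule) = 1 := by
      rw [← (IntertwiningMap.equivAlgEnd (ρ := ρ)).toLinearEquiv.finrank_eq, hρ]
    have h2 : (1 : Module.End (MonoidAlgebra ℂ G) ρ.asModule) ≠ 0 := by
      intro h0
      have : Subsingleton (Module.End (MonoidAlgebra ℂ G) ρ.asModule) :=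
        subsingleton_of_zero_eq_one h0.symm
      rw [Module.finrank_zero_of_subsingleton] at h1
      exact zero_ne_one h1
    exact (finrank_eq_one_iff_of_nonzero' 1 h2).1 h1
  rw [irreducible_iff_isSimpleModule_asModule, isSimpleModule_iff]
  have hnt : Nontrivial ρ.asModule := by
    by_contra hcon
    rw [not_nontrivial_iff_subsingleton] at hcon
    have : Subsingleton (IntertwiningMap ρ ρ) :=
      ⟨fun f g => IntertwiningMap.ext (LinearMap.ext fun v => @Subsingleton.elim V hcon _ _)⟩
    rw [Module.finrank_zero_of_subsingleton] at hρ
    exact zero_ne_one hρ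
  refine { eq_bot_or_eq_top := fun U => ?_ }
  have : NeZero (Nat.card G : ℂ) := ⟨Nat.cast_ne_zero.2 Nat.card_pos.ne'⟩
  obtain ⟨U', hU⟩ := MonoidAlgebra.Submodule.exists_isCompl U
  let e : Module.End (MonoidAlgebra ℂ G) ρ.asModule := U.projection U' hU
  obtain ⟨c, hc⟩ := hend e
  by_cases hc0 : c = 0
  · left
    refine (Submodule.eq_bot_iff _).2 fun x hx => ?_
    have h1 : e x = x := Submodule.projection_apply_of_mem_left hU hx
    rw [← h1, ← hc, hc0, zero_smul, LinearMap.zero_apply]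
  · right
    refine eq_top_iff.2 fun x _ => ?_
    have h1 : e x ∈ U := Submodule.projection_apply_mem hU x
    rw [← hc] at h1
    have h2 := Submodule.smul_of_tower_mem U c⁻¹ h1
    rwa [LinearMap.smul_apply, Module.End.one_apply, smul_smul, inv_mul_cancel₀ hc0,
      one_smul] at h2

end Irreducible

/-! ### The character of the representation attached to a linear form -/

section Character

variable {K : Type*} [Field K] {N p : ℕ} {𝔤 : LieSubalgebra K (Matrix (Fin N) (Fin N) K)}

instance : FiniteDimensional K 𝔤 := inferInstanceAs (FiniteDimensional K 𝔤.toSubmodule)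

theorem IsPolarization.natCard_mul_self [Finite K] {lam : Module.Dual K 𝔤} {𝔭 : LieSubalgebra K 𝔤}
    (h𝔭 : IsPolarization lam 𝔭) : Nat.card 𝔭.toSubmodule * Nat.card 𝔭.toSubmodule =
      Nat.card 𝔤 * Nat.card (stabilizer lam) := by
  rw [Module.natCard_eq_pow_finrank (K := K) (V := 𝔭.toSubmodule),
    Module.natCard_eq_pow_finrank (K := K) (V := 𝔤),
    Module.natCard_eq_pow_finrank (K := K) (V := stabilizer lam), ← pow_add, ← pow_add,
    ← h𝔭.two_mul_finrank, two_mul]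

theorem natCard_mul_natCard_dualAnnihilator [Finite K] (W : Submodule K 𝔤) :
    Nat.card W * Nat.card W.dualAnnihilator = Nat.card 𝔤 := by
  rw [Module.natCard_eq_pow_finrank (K := K) (V := W),
    Module.natCard_eq_pow_finrank (K := K) (V := 𝔤),
    Module.natCard_eq_pow_finrank (K := K) (V := W.dualAnnihilator), ← pow_add,
    Subspace.finrank_add_finrank_dualAnnihilator_eq]

variable [CharP K p] [Fact p.Prime]

theorem natCard_expGroup (h : IsAdmissible p 𝔤) : Nat.card (expGroup p 𝔤) = Nat.card 𝔤 :=
  (Nat.card_congr (expEquiv h)).symm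

variable (h : IsAdmissible p 𝔤)

theorem natCard_expSubgroup (𝔭 : LieSubalgebra K 𝔤) :
    Nat.card (expSubgroup h 𝔭) = Nat.card 𝔭.toSubmodule :=
  (Nat.card_congr ((expEquiv h).subtypeEquiv fun _ => (expMap_mem_expSubgroup_iff h).symm)).symm

theorem natCard_coAd_eq_self (lam : Module.Dual K 𝔤) :
    Nat.card {g // coAd h g lam = lam} = Nat.card (stabilizer lam) :=
  (Nat.card_congr ((expEquiv h).subtypeEquiv fun _ => (coAd_expMap_eq_self_iff h).symm)).symm

theorem natCard_expSubgroup_coAd_eq_self {lam : Module.Dual K 𝔤} {𝔭 : LieSubalgebra K 𝔤}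
    (h𝔭 : IsPolarization lam 𝔭) :
    Nat.card {u : expSubgroup h 𝔭 // coAd h u lam = lam} = Nat.card (stabilizer lam) := by
  rw [← natCard_coAd_eq_self h]
  refine Nat.card_congr ⟨fun u => ⟨u.1, u.2⟩, fun g => ⟨⟨g.1, ?_⟩, g.2⟩, fun _ => rfl, fun _ => rfl⟩
  obtain ⟨g, hg⟩ := g
  obtain ⟨x, rfl⟩ := expMap_surjective h g
  rw [coAd_expMap_eq_self_iff] at hg
  exact (expMap_mem_expSubgroup_iff h).2 (h𝔭.stabilizer_le hg)

theorem Ad_eq_symm_conj (g : expGroup p 𝔤) (x : 𝔤) :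
    (expEquiv h).symm (g * expMap h x * g⁻¹) = Ad h g x := by
  rw [conj_expMap, expEquiv_symm_expMap]

variable [Finite K]

open Classical in
/-- The group `exp 𝔭` of a polarization `𝔭` of `lam` acts transitively on the linear forms which
agree with `lam` on `𝔭`. -/
theorem image_coAd_expSubgroup {lam : Module.Dual K 𝔤} {𝔭 : LieSubalgebra K 𝔤}
    (h𝔭 : IsPolarization lam 𝔭) [Fintype (expSubgroup h 𝔭)]
    [Fintype 𝔭.toSubmodule.dualAnnihilator] :
    (Finset.univ.image fun u : expSubgroup h 𝔭 => coAd h u lam) =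
      Finset.univ.image fun ν : 𝔭.toSubmodule.dualAnnihilator => lam + ν := by
  have : Finite 𝔤 := Module.finite_of_finite K
  refine Finset.eq_of_subset_of_card_le ?_ ?_
  · intro μ hμ
    obtain ⟨⟨u, hu⟩, -, rfl⟩ := Finset.mem_image.1 hμ
    obtain ⟨x, rfl⟩ := expMap_surjective h u
    rw [expMap_mem_expSubgroup_iff] at hu
    refine Finset.mem_image.2 ⟨⟨coAd h (expMap h x) lam - lam, ?_⟩, Finset.mem_univ _, by simp⟩
    rw [Submodule.mem_dualAnnihilator]
    intro y hy
    rw [LinearMap.sub_apply, coAd_expMap_apply_of_mem h h𝔭.1 hu hy, sub_self]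
  · have hinj : Function.Injective fun ν : 𝔭.toSubmodule.dualAnnihilator =>
        lam + (ν : Module.Dual K 𝔤) := fun a b hab => Subtype.ext (add_right_injective lam hab)
    rw [Finset.card_image_of_injective _ hinj,
      Finset.card_univ, ← Nat.card_eq_fintype_card]
    -- The orbit has `|𝔭| / |𝔤^lam|` elements and the affine space has `|𝔤| / |𝔭|`; these agree
    -- since `|𝔭|² = |𝔤| |𝔤^lam|`.
    have h1 := card_eq_card_mul_card_image ((coAd h).comp (expSubgroup h 𝔭).subtype) lam
    simp only [MonoidHom.comp_apply, Subgroup.subtype_apply] at h1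
    rw [natCard_expSubgroup, natCard_expSubgroup_coAd_eq_self h h𝔭] at h1
    have h2 := h𝔭.natCard_mul_self
    have h3 := natCard_mul_natCard_dualAnnihilator 𝔭.toSubmodule
    have hs : 0 < Nat.card (stabilizer lam) := Nat.card_pos
    have hp : 0 < Nat.card 𝔭.toSubmodule := Nat.card_pos
    refine le_of_eq (Nat.eq_of_mul_eq_mul_left (Nat.mul_pos hs hp) ?_)
    rw [mul_assoc, h3, mul_comm _ (Nat.card 𝔤), ← h2, mul_right_comm, ← h1]

open Classical in
/-- The extension by zero of the character `exp x ↦ ψ (lam x)` of `exp 𝔭`. -/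
def extendedCharacter (ψ : AddChar K ℂ) (lam : Module.Dual K 𝔤) (𝔭 : LieSubalgebra K 𝔤)
    (x : 𝔤) : ℂ :=
  if x ∈ 𝔭 then ψ (lam x) else 0

/-- The orbit of `lam` under `P` is `lam + 𝔭^⊥`, and the sum of `ψ (ν x)` over `ν ∈ 𝔭^⊥` vanishes
unless `x` is killed by `𝔭^⊥`, that is, unless `x ∈ 𝔭`. -/
theorem extendedCharacter_eq {ψ : AddChar K ℂ} (hψ : ψ ≠ 1) {lam : Module.Dual K 𝔤}
    {𝔭 : LieSubalgebra K 𝔤} (h𝔭 : IsPolarization lam 𝔭) [Fintype (expSubgroup h 𝔭)] (x : 𝔤) :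
    extendedCharacter ψ lam 𝔭 x =
      (Nat.card (expSubgroup h 𝔭) : ℂ)⁻¹ * ∑ u : expSubgroup h 𝔭, ψ (coAd h u lam x) := by
  classical
  have : Finite 𝔤 := Module.finite_of_finite K
  have : Finite (Module.Dual K 𝔤) := Module.finite_of_finite K
  have := Fintype.ofFinite 𝔭.toSubmodule.dualAnnihilator
  have hp : (Nat.card 𝔭.toSubmodule : ℂ) ≠ 0 := Nat.cast_ne_zero.2 Nat.card_pos.ne'
  have h1 := sum_apply_eq_card_mul_sum ((coAd h).comp (expSubgroup h 𝔭).subtype) lam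
    (fun μ => ψ (μ x))
  simp only [MonoidHom.comp_apply, Subgroup.subtype_apply] at h1
  rw [h1, natCard_expSubgroup_coAd_eq_self h h𝔭, image_coAd_expSubgroup h h𝔭,
    Finset.sum_image fun a _ b _ hab => Subtype.ext (add_right_injective lam hab)]
  simp only [LinearMap.add_apply, AddChar.map_add_eq_mul]
  rw [← Finset.mul_sum, natCard_expSubgroup]
  have h2 := sum_addChar_apply (V := 𝔭.toSubmodule.dualAnnihilator) hψ
    (𝔭.toSubmodule.dualAnnihilator.subtype.flip x)
  simp only [LinearMap.flip_apply, Submodule.subtype_apply] at h2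
  have h3 : 𝔭.toSubmodule.dualAnnihilator.subtype.flip x = 0 ↔ x ∈ 𝔭 := by
    rw [← LieSubalgebra.mem_toSubmodule, ← Subspace.forall_mem_dualAnnihilator_apply_eq_zero_iff,
      LinearMap.ext_iff]
    exact Subtype.forall
  rw [h2, extendedCharacter]
  by_cases hx : x ∈ 𝔭
  · rw [if_pos hx, if_pos (h3.2 hx)]
    have h4 : (Nat.card (stabilizer lam) : ℂ) * Nat.card 𝔭.toSubmodule.dualAnnihilator =
        Nat.card 𝔭.toSubmodule := by
      refine mul_left_cancel₀ hp ?_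
      have h5 := h𝔭.natCard_mul_self
      rw [← natCard_mul_natCard_dualAnnihilator 𝔭.toSubmodule] at h5
      rw [mul_left_comm, mul_comm (Nat.card (stabilizer lam) : ℂ)]
      exact_mod_cast h5.symm
    rw [mul_left_comm (Nat.card (stabilizer lam) : ℂ), h4, mul_comm (ψ (lam x)),
      inv_mul_cancel_left₀ hp]
  · rw [if_neg hx, if_neg (h3.not.2 hx), mul_zero, mul_zero, mul_zero]

instance finite_orbitSpace (ψ : AddChar K ℂ) (lam : Module.Dual K 𝔤) (𝔭 : LieSubalgebra K 𝔤) :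
    FiniteDimensional ℂ (OrbitSpace h ψ lam 𝔭) := by
  have : Finite 𝔤 := Module.finite_of_finite K
  have : Finite (expGroup p 𝔤) := Finite.of_equiv _ (expEquiv h)
  exact finite_indV _ _

/-- The **Kirillov character formula**. -/
theorem character_orbitRep {ψ : AddChar K ℂ} (hψ : ψ ≠ 1) {lam : Module.Dual K 𝔤}
    {𝔭 : LieSubalgebra K 𝔤} (h𝔭 : IsPolarization lam 𝔭) [Fintype (expGroup p 𝔤)] (x : 𝔤) :
    (orbitRep h ψ lam 𝔭).character (expMap h x) =
      (Nat.card (expSubgroup h 𝔭) : ℂ)⁻¹ * ∑ g, ψ (coAd h g lam x) := by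
  have := Fintype.ofFinite (expSubgroup h 𝔭)
  have hP : (Nat.card (expSubgroup h 𝔭) : ℂ) ≠ 0 := Nat.cast_ne_zero.2 Nat.card_pos.ne'
  rw [orbitRep, character_ind_charRep (expSubgroup h 𝔭) (orbitCharacter h ψ lam 𝔭)
    (f := fun g => extendedCharacter ψ lam 𝔭 ((expEquiv h).symm g))]
  · congr 1
    simp_rw [Ad_eq_symm_conj, extendedCharacter_eq h hψ h𝔭]
    rw [← Finset.mul_sum, Finset.sum_comm]
    -- The substitution `g = s⁻¹ u` absorbs `u` into the sum over `G`, so the average over `P` is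
    -- trivial.
    have h1 : ∀ u : expSubgroup h 𝔭, ∑ s, ψ (coAd h u lam (Ad h s x)) =
        ∑ g, ψ (coAd h g lam x) := by
      intro u
      refine Fintype.sum_equiv ((Equiv.inv _).trans (Equiv.mulRight (u : expGroup p 𝔤))) _ _
        fun s => ?_
      change _ = ψ (coAd h (s⁻¹ * u) lam x)
      rw [map_mul, Module.End.mul_apply, coAd_apply h s⁻¹, inv_inv]
    rw [Finset.sum_congr rfl fun u _ => h1 u, Finset.sum_const, Finset.card_univ,
      ← Nat.card_eq_fintype_card, nsmul_eq_mul, inv_mul_cancel_left₀ hP]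
  · rintro ⟨u, hu⟩
    obtain ⟨y, rfl⟩ := expMap_surjective h u
    have hy := (expMap_mem_expSubgroup_iff h).1 hu
    rw [expEquiv_symm_expMap, extendedCharacter, if_pos hy]
    exact (isOrbitCharacter_orbitCharacter h ψ h𝔭.1 y hy).symm
  · intro g hg
    obtain ⟨y, rfl⟩ := expMap_surjective h g
    rw [expMap_mem_expSubgroup_iff] at hg
    rw [expEquiv_symm_expMap, extendedCharacter, if_neg hg]

end Character

/-! ### Orthogonality relations and the dimension formula -/

section Orthogonality

theorem IsPolarization.orbitDim_eq {K L : Type*} [Field K] [LieRing L] [LieAlgebra K L]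
    [FiniteDimensional K L] {lam : Module.Dual K L} {𝔭 : LieSubalgebra K L}
    (h𝔭 : IsPolarization lam 𝔭) :
    orbitDim lam = 2 * (Module.finrank K L - Module.finrank K 𝔭.toSubmodule) := by
  have := h𝔭.two_mul_finrank
  rw [orbitDim]
  omega

variable {K : Type*} [Field K] [Finite K] {N p : ℕ}
  {𝔤 : LieSubalgebra K (Matrix (Fin N) (Fin N) K)} [CharP K p] [Fact p.Prime]
  (h : IsAdmissible p 𝔤) {ψ : AddChar K ℂ} (hψ : ψ ≠ 1)

include h in
theorem finite_expGroup : Finite (expGroup p 𝔤) :=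
  have : Finite 𝔤 := Module.finite_of_finite K
  Finite.of_equiv _ (expEquiv h)

-- Transported to `𝔤` by `exp`, only pairs `(s, t)` that give the same linear form survive; each
-- contributes `|𝔤| = |G|`, which cancels the normalization.
include hψ in
theorem sum_character_mul_character [Fintype (expGroup p 𝔤)] [DecidableEq (Module.Dual K 𝔤)]
    {lam lam' : Module.Dual K 𝔤}
    {𝔭 𝔭' : LieSubalgebra K 𝔤} (h𝔭 : IsPolarization lam 𝔭) (h𝔭' : IsPolarization lam' 𝔭') :
    (Nat.card (expGroup p 𝔤) : ℂ)⁻¹ * ∑ g, (orbitRep h ψ lam 𝔭).character g *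
        (orbitRep h ψ lam' 𝔭').character g⁻¹ =
      (Nat.card (expSubgroup h 𝔭) : ℂ)⁻¹ * (Nat.card (expSubgroup h 𝔭') : ℂ)⁻¹ *
        ∑ t, (Finset.univ.filter fun s => coAd h s lam = coAd h t lam').card := by
  have : Finite 𝔤 := Module.finite_of_finite K
  have := Fintype.ofFinite 𝔤
  have hG : (Nat.card 𝔤 : ℂ) ≠ 0 := Nat.cast_ne_zero.2 Nat.card_pos.ne'
  have h1 : ∀ s t : expGroup p 𝔤, ∑ x : 𝔤, ψ (coAd h s lam x) * ψ (coAd h t lam' (-x)) =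
      if coAd h s lam = coAd h t lam' then (Nat.card 𝔤 : ℂ) else 0 := by
    intro s t
    have h2 := sum_addChar_apply (V := 𝔤) hψ (coAd h s lam - coAd h t lam')
    rw [if_congr sub_eq_zero rfl rfl] at h2
    rw [← h2]
    refine Finset.sum_congr rfl fun x _ => ?_
    rw [← AddChar.map_add_eq_mul, LinearMap.sub_apply, map_neg, sub_eq_add_neg]
  have h3 : ∑ g, (orbitRep h ψ lam 𝔭).character g * (orbitRep h ψ lam' 𝔭').character g⁻¹ =
      ∑ x, (orbitRep h ψ lam 𝔭).character (expMap h x) *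
        (orbitRep h ψ lam' 𝔭').character (expMap h (-x)) := by
    refine (Fintype.sum_equiv (expEquiv h) _ _ fun x => ?_).symm
    rw [expEquiv_apply, expMap_neg]
  have h4 : ∀ x : 𝔤, (orbitRep h ψ lam 𝔭).character (expMap h x) *
      (orbitRep h ψ lam' 𝔭').character (expMap h (-x)) =
        (Nat.card (expSubgroup h 𝔭) : ℂ)⁻¹ * (Nat.card (expSubgroup h 𝔭') : ℂ)⁻¹ *
          ((∑ s, ψ (coAd h s lam x)) * ∑ t, ψ (coAd h t lam' (-x))) := fun x => by
    rw [character_orbitRep h hψ h𝔭, character_orbitRep h hψ h𝔭', mul_mul_mul_comm]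
  rw [h3, Finset.sum_congr rfl fun x _ => h4 x, ← Finset.mul_sum, sum_mul_sum_eq_card h1,
    natCard_expGroup h, mul_left_comm, inv_mul_cancel_left₀ hG, Nat.cast_sum]

-- The norm of the character is `|G| |𝔤^lam| / |P|² = 1`.
include hψ in
theorem isIrreducible_orbitRep {lam : Module.Dual K 𝔤} {𝔭 : LieSubalgebra K 𝔤}
    (h𝔭 : IsPolarization lam 𝔭) : (orbitRep h ψ lam 𝔭).IsIrreducible := by
  classical
  have := finite_expGroup h
  have : Finite 𝔤 := Module.finite_of_finite K
  have := Fintype.ofFinite (expGroup p 𝔤)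
  have hG : (Nat.card (expGroup p 𝔤) : ℂ) ≠ 0 := Nat.cast_ne_zero.2 Nat.card_pos.ne'
  have hP : (Nat.card (expSubgroup h 𝔭) : ℂ) ≠ 0 := Nat.cast_ne_zero.2 Nat.card_pos.ne'
  have := invertibleOfNonzero hG
  refine isIrreducible_of_finrank_intertwiningMap (Nat.cast_injective (R := ℂ) ?_)
  rw [← Representation.card_inv_mul_sum_char_mul_char_eq_finrank,
    sum_character_mul_character h hψ h𝔭 h𝔭]
  have h1 : ∀ t, (Finset.univ.filter fun s => coAd h s lam = coAd h t lam).card =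
      Nat.card (stabilizer lam) := fun t => by
    rw [card_filter_apply_eq, natCard_coAd_eq_self]
  simp_rw [h1]
  rw [Finset.sum_const, Finset.card_univ, smul_eq_mul, ← Nat.card_eq_fintype_card,
    natCard_expGroup h, ← h𝔭.natCard_mul_self, ← natCard_expSubgroup h, Nat.cast_mul,
    Nat.cast_one, ← mul_inv, inv_mul_cancel₀ (mul_ne_zero hP hP)]

-- For irreducible representations equivalence means a nonzero inner product, and the inner product
-- counts the ways in which the two orbits meet.
include hψ in
theorem nonempty_equiv_orbitRep_iff {lam lam' : Module.Dual K 𝔤} {𝔭 𝔭' : LieSubalgebra K 𝔤}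
    (h𝔭 : IsPolarization lam 𝔭) (h𝔭' : IsPolarization lam' 𝔭') :
    Nonempty ((orbitRep h ψ lam 𝔭).Equiv (orbitRep h ψ lam' 𝔭')) ↔
      coadjointOrbit h lam = coadjointOrbit h lam' := by
  classical
  have := finite_expGroup h
  have := Fintype.ofFinite (expGroup p 𝔤)
  have hG : (Nat.card (expGroup p 𝔤) : ℂ) ≠ 0 := Nat.cast_ne_zero.2 Nat.card_pos.ne'
  have hP : (Nat.card (expSubgroup h 𝔭) : ℂ) ≠ 0 := Nat.cast_ne_zero.2 Nat.card_pos.ne'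
  have hP' : (Nat.card (expSubgroup h 𝔭') : ℂ) ≠ 0 := Nat.cast_ne_zero.2 Nat.card_pos.ne'
  have := invertibleOfNonzero hG
  have hirr := isIrreducible_orbitRep h hψ h𝔭
  have hirr' := isIrreducible_orbitRep h hψ h𝔭'
  have h1 := Representation.char_orthonormal (orbitRep h ψ lam' 𝔭') (orbitRep h ψ lam 𝔭)
  rw [sum_character_mul_character h hψ h𝔭' h𝔭] at h1
  have h2 : Nonempty ((orbitRep h ψ lam 𝔭).Equiv (orbitRep h ψ lam' 𝔭')) ↔
      ∑ t, (Finset.univ.filter fun s => coAd h s lam' = coAd h t lam).card ≠ 0 := by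
    constructor
    · intro hne h0
      rw [if_pos hne, h0, Nat.cast_zero, mul_zero] at h1
      exact zero_ne_one h1
    · intro hne
      by_contra hcon
      rw [if_neg hcon] at h1
      exact mul_ne_zero (mul_ne_zero (inv_ne_zero hP') (inv_ne_zero hP)) (Nat.cast_ne_zero.2 hne) h1
  rw [h2, Ne, Finset.sum_eq_zero_iff, not_forall]
  constructor
  · rintro ⟨t, ht⟩
    obtain ⟨s, hs⟩ : ∃ s, coAd h s lam' = coAd h t lam := by
      by_contra! hcon
      exact ht fun _ => Finset.card_eq_zero.2 (Finset.filter_eq_empty_iff.2 fun s _ => hcon s)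
    have h3 : ∀ {μ ν : Module.Dual K 𝔤} {a b : expGroup p 𝔤}, coAd h a μ = coAd h b ν →
        coadjointOrbit h μ ⊆ coadjointOrbit h ν := by
      rintro μ ν a b hab _ ⟨g, rfl⟩
      refine ⟨g * a⁻¹ * b, ?_⟩
      change coAd h (g * a⁻¹ * b) ν = coAd h g μ
      rw [map_mul, Module.End.mul_apply, ← hab, ← Module.End.mul_apply, ← map_mul,
        inv_mul_cancel_right]
    exact (h3 hs.symm).antisymm (h3 hs)
  · intro ho
    obtain ⟨s, hs⟩ : lam ∈ coadjointOrbit h lam' := by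
      rw [← ho]
      exact ⟨1, by simp⟩
    refine ⟨1, fun hcon => ?_⟩
    have h3 := Finset.card_eq_zero.1 (hcon (Finset.mem_univ _))
    have h4 : s ∈ (∅ : Finset (expGroup p 𝔤)) := by
      rw [← h3, Finset.mem_filter]
      refine ⟨Finset.mem_univ _, ?_⟩
      rw [map_one]
      exact hs
    exact absurd h4 (Finset.notMem_empty s)

include hψ in
theorem exists_equiv_orbitRep {V : Type*} [AddCommGroup V] [Module ℂ V]
    {T : Representation ℂ (expGroup p 𝔤) V} (hT : T.IsIrreducible) :
    ∃ lam : Module.Dual K 𝔤, ∀ 𝔭 : LieSubalgebra K 𝔤, IsPolarization lam 𝔭 →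
      Nonempty (T.Equiv (orbitRep h ψ lam 𝔭)) := by
  classical
  have := finite_expGroup h
  have : Finite 𝔤 := Module.finite_of_finite K
  have : Finite (Module.Dual K 𝔤) := Module.finite_of_finite K
  have := Fintype.ofFinite (expGroup p 𝔤)
  have := Fintype.ofFinite 𝔤
  have := Fintype.ofFinite (Module.Dual K 𝔤)
  have := finiteDimensional_of_isIrreducible hT
  have hG : (Nat.card (expGroup p 𝔤) : ℂ) ≠ 0 := Nat.cast_ne_zero.2 Nat.card_pos.ne'
  have hD : (Nat.card (Module.Dual K 𝔤) : ℂ) ≠ 0 := Nat.cast_ne_zero.2 Nat.card_pos.ne'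
  have := invertibleOfNonzero hG
  choose 𝔭 h𝔭 using h.exists_isPolarization
  have h1 : ∀ (s : expGroup p 𝔤) (x : 𝔤), ∑ lam, ψ (coAd h s lam x) =
      if x = 0 then (Nat.card (Module.Dual K 𝔤) : ℂ) else 0 := by
    intro s x
    have h2 := sum_addChar_apply (V := Module.Dual K 𝔤) hψ (Module.Dual.eval K 𝔤 x)
    have h3 : Module.Dual.eval K 𝔤 x = 0 ↔ x = 0 := by
      rw [← Module.forall_dual_apply_eq_zero_iff K x]
      exact LinearMap.ext_iff
    rw [if_congr h3 rfl rfl] at h2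
    rw [← h2]
    refine Fintype.sum_bijective (coAd h s) ⟨fun a b hab => ?_, fun b => ⟨coAd h s⁻¹ b, ?_⟩⟩ _ _
      fun lam => rfl
    · rw [← Representation.inv_self_apply (coAd h) s a, hab, Representation.inv_self_apply]
    · rw [Representation.self_inv_apply]
  obtain ⟨lam, hlam⟩ : ∃ lam, ∑ g, (orbitRep h ψ lam (𝔭 lam)).character g * T.character g⁻¹ ≠ 0 := by
    by_contra! hcon
    -- The factor `|P|⁻¹` depends on `lam`, so it is removed before summing over `lam`. That sum
    -- leaves only `x = 0` and yields `|G| |𝔤*| dim V = 0`.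
    have h2 : ∀ lam, ∑ x, (∑ s, ψ (coAd h s lam x)) * T.character (expMap h x)⁻¹ = 0 := by
      intro lam
      have hP : (Nat.card (expSubgroup h (𝔭 lam)) : ℂ) ≠ 0 := Nat.cast_ne_zero.2 Nat.card_pos.ne'
      have h3 := hcon lam
      rw [← (expEquiv h).sum_comp] at h3
      simp_rw [expEquiv_apply, character_orbitRep h hψ (h𝔭 lam), mul_assoc] at h3
      rw [← Finset.mul_sum] at h3
      exact (mul_eq_zero.1 h3).resolve_left (inv_ne_zero hP)
    have h3 : ∑ lam, ∑ x, (∑ s, ψ (coAd h s lam x)) * T.character (expMap h x)⁻¹ = 0 :=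
      Finset.sum_eq_zero fun lam _ => h2 lam
    rw [Finset.sum_comm] at h3
    simp_rw [← Finset.sum_mul] at h3
    have h4 : ∀ x : 𝔤, ∑ lam, ∑ s, ψ (coAd h s lam x) = if x = 0 then
        (Nat.card (expGroup p 𝔤) : ℂ) * Nat.card (Module.Dual K 𝔤) else 0 := by
      intro x
      rw [Finset.sum_comm]
      simp_rw [h1]
      rw [Finset.sum_const, Finset.card_univ, nsmul_eq_mul, ← Nat.card_eq_fintype_card, mul_ite,
        mul_zero]
    simp_rw [h4, ite_mul, zero_mul] at h3
    rw [Finset.sum_ite_eq' Finset.univ, if_pos (Finset.mem_univ _), expMap_zero, inv_one,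
      Representation.char_one] at h3
    have hV : Module.finrank ℂ V ≠ 0 := by
      have h5 : Nontrivial V := by
        have h6 : Nontrivial T.asModule :=
          IsSimpleModule.nontrivial (MonoidAlgebra ℂ (expGroup p 𝔤)) T.asModule
        exact h6
      exact Module.finrank_pos.ne'
    exact mul_ne_zero (mul_ne_zero hG hD) (Nat.cast_ne_zero.2 hV) h3
  have hirr := isIrreducible_orbitRep h hψ (h𝔭 lam)
  obtain ⟨e⟩ : Nonempty (T.Equiv (orbitRep h ψ lam (𝔭 lam))) := by
    by_contra hcon
    have h2 := Representation.char_orthonormal (orbitRep h ψ lam (𝔭 lam)) T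
    rw [if_neg hcon] at h2
    exact mul_ne_zero (inv_ne_zero hG) hlam h2
  refine ⟨lam, fun 𝔮 h𝔮 => ?_⟩
  obtain ⟨e'⟩ := (nonempty_equiv_orbitRep_iff h hψ (h𝔭 lam) h𝔮).2 rfl
  exact ⟨e.trans e'⟩

-- The character formula at `x = 0` gives the index of `P` in `G`.
include hψ in
theorem finrank_orbitSpace {lam : Module.Dual K 𝔤} {𝔭 : LieSubalgebra K 𝔤}
    (h𝔭 : IsPolarization lam 𝔭) : Module.finrank ℂ (OrbitSpace h ψ lam 𝔭) =
      Nat.card K ^ (Module.finrank K 𝔤 - Module.finrank K 𝔭.toSubmodule) := by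
  have := finite_expGroup h
  have := Fintype.ofFinite (expGroup p 𝔤)
  have : Finite 𝔤 := Module.finite_of_finite K
  have hP : (Nat.card (expSubgroup h 𝔭) : ℂ) ≠ 0 := Nat.cast_ne_zero.2 Nat.card_pos.ne'
  have h1 := character_orbitRep h hψ h𝔭 0
  rw [expMap_zero, Representation.char_one] at h1
  simp only [map_zero, AddChar.map_zero_eq_one, Finset.sum_const, Finset.card_univ,
    nsmul_eq_mul, mul_one] at h1
  rw [← Nat.card_eq_fintype_card, natCard_expGroup h, eq_inv_mul_iff_mul_eq₀ hP] at h1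
  have h2 : Nat.card 𝔭.toSubmodule * Module.finrank ℂ (OrbitSpace h ψ lam 𝔭) = Nat.card 𝔤 := by
    rw [← natCard_expSubgroup h]
    exact_mod_cast h1
  refine Nat.eq_of_mul_eq_mul_left (Nat.card_pos (α := 𝔭.toSubmodule)) ?_
  rw [h2, Module.natCard_eq_pow_finrank (K := K) (V := 𝔭.toSubmodule),
    Module.natCard_eq_pow_finrank (K := K) (V := 𝔤), ← pow_add,
    Nat.add_sub_cancel' (Submodule.finrank_le _)]

theorem natCard_coadjointOrbit (lam : Module.Dual K 𝔤) :
    Nat.card (coadjointOrbit h lam) = Nat.card K ^ orbitDim lam := by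
  classical
  have := finite_expGroup h
  have := Fintype.ofFinite (expGroup p 𝔤)
  have : Finite 𝔤 := Module.finite_of_finite K
  have h1 := card_eq_card_mul_card_image (coAd h) lam
  have h2 : coadjointOrbit h lam = ((Finset.univ.image fun u => coAd h u lam : Finset _) : Set _) := by
    simp [coadjointOrbit]
  rw [natCard_expGroup h, natCard_coAd_eq_self, Module.natCard_eq_pow_finrank (K := K) (V := 𝔤),
    Module.natCard_eq_pow_finrank (K := K) (V := stabilizer lam)] at h1
  rw [h2, Nat.card_coe_set_eq, Set.ncard_coe_finset]
  refine Nat.eq_of_mul_eq_mul_left (pow_pos (Nat.card_pos (α := K))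
    (Module.finrank K (stabilizer lam))) ?_
  rw [← h1, orbitDim, ← pow_add, Nat.add_sub_cancel' (Submodule.finrank_le _)]

end Orthogonality

end OrbitMethod

end

theorem mainTheorem2 {K : Type*} [Field K] [Finite K] {p : ℕ} [CharP K p] [Fact p.Prime]
    {N : ℕ} {𝔤 : LieSubalgebra K (Matrix (Fin N) (Fin N) K)}
    (h : OrbitMethod.IsAdmissible p 𝔤) (ψ : AddChar K ℂ) (hψ : ψ ≠ 1) :
    -- the objects are well defined: `exp : 𝔤 → G` is bijective, every linear form has a
    -- polarization, `P = exp 𝔭`, and `ξ(exp x) = ψ(lam x)` defines a unique character of `P`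
    Function.Bijective (OrbitMethod.expMap h) ∧
    (∀ lam : Module.Dual K 𝔤, ∃ 𝔭 : LieSubalgebra K 𝔤, OrbitMethod.IsPolarization lam 𝔭) ∧
    (∀ (lam : Module.Dual K 𝔤) (𝔭 : LieSubalgebra K 𝔤), OrbitMethod.IsPolarization lam 𝔭 →
      (OrbitMethod.expSubgroup h 𝔭 : Set (OrbitMethod.expGroup p 𝔤)) =
        OrbitMethod.expMap h '' (𝔭 : Set 𝔤) ∧
      OrbitMethod.IsOrbitCharacter h ψ lam 𝔭 (OrbitMethod.orbitCharacter h ψ lam 𝔭) ∧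
      ∀ χ, OrbitMethod.IsOrbitCharacter h ψ lam 𝔭 χ →
        χ = OrbitMethod.orbitCharacter h ψ lam 𝔭) ∧
    -- 1) the dimension
    (∀ (lam : Module.Dual K 𝔤) (𝔭 : LieSubalgebra K 𝔤), OrbitMethod.IsPolarization lam 𝔭 →
      (Module.finrank ℂ (OrbitMethod.OrbitSpace h ψ lam 𝔭) : ℝ) =
        (Nat.card K : ℝ) ^ ((OrbitMethod.orbitDim lam : ℝ) / 2) ∧
      (Module.finrank ℂ (OrbitMethod.OrbitSpace h ψ lam 𝔭) : ℝ) =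
        Real.sqrt (Nat.card (OrbitMethod.coadjointOrbit h lam))) ∧
    -- 2) independence of the polarization
    (∀ (lam : Module.Dual K 𝔤) (𝔭 𝔭' : LieSubalgebra K 𝔤),
      OrbitMethod.IsPolarization lam 𝔭 → OrbitMethod.IsPolarization lam 𝔭' →
      Nonempty ((OrbitMethod.orbitRep h ψ lam 𝔭).Equiv (OrbitMethod.orbitRep h ψ lam 𝔭'))) ∧
    -- 3) irreducibility
    (∀ (lam : Module.Dual K 𝔤) (𝔭 : LieSubalgebra K 𝔤), OrbitMethod.IsPolarization lam 𝔭 →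
      (OrbitMethod.orbitRep h ψ lam 𝔭).IsIrreducible) ∧
    -- 4) equivalence of two such representations
    (∀ (lam lam' : Module.Dual K 𝔤) (𝔭 𝔭' : LieSubalgebra K 𝔤),
      OrbitMethod.IsPolarization lam 𝔭 → OrbitMethod.IsPolarization lam' 𝔭' →
      (Nonempty ((OrbitMethod.orbitRep h ψ lam 𝔭).Equiv (OrbitMethod.orbitRep h ψ lam' 𝔭')) ↔
        OrbitMethod.coadjointOrbit h lam = OrbitMethod.coadjointOrbit h lam')) ∧
    -- 5) every irreducible complex representation of `G` is obtained
    (∀ (V : Type*) [AddCommGroup V] [Module ℂ V]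
      (T : Representation ℂ (OrbitMethod.expGroup p 𝔤) V), T.IsIrreducible →
      ∃ lam : Module.Dual K 𝔤, ∀ 𝔭 : LieSubalgebra K 𝔤, OrbitMethod.IsPolarization lam 𝔭 →
        Nonempty (T.Equiv (OrbitMethod.orbitRep h ψ lam 𝔭))) := by
  refine ⟨OrbitMethod.expMap_bijective h, h.exists_isPolarization, fun lam 𝔭 h𝔭 => ?_,
    fun lam 𝔭 h𝔭 => ?_, fun lam 𝔭 𝔭' h𝔭 h𝔭' => ?_,
    fun lam 𝔭 h𝔭 => OrbitMethod.isIrreducible_orbitRep h hψ h𝔭,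
    fun lam lam' 𝔭 𝔭' h𝔭 h𝔭' => OrbitMethod.nonempty_equiv_orbitRep_iff h hψ h𝔭 h𝔭',
    fun V _ _ T hT => OrbitMethod.exists_equiv_orbitRep h hψ hT⟩
  · have hχ := OrbitMethod.isOrbitCharacter_orbitCharacter h ψ h𝔭.1
    exact ⟨OrbitMethod.coe_expSubgroup h 𝔭, hχ, fun χ hχ' => hχ'.unique h hχ⟩
  -- The orbit dimension is twice the codimension of `𝔭`, so both expressions reduce to `q` to that
  -- codimension.
  · rw [OrbitMethod.finrank_orbitSpace h hψ h𝔭, OrbitMethod.natCard_coadjointOrbit,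
      h𝔭.orbitDim_eq, mul_comm 2, pow_mul]
    push_cast
    rw [Real.sqrt_sq (by positivity), mul_div_assoc, div_self two_ne_zero, mul_one,
      Real.rpow_natCast]
    exact ⟨rfl, rfl⟩
  · exact (OrbitMethod.nonempty_equiv_orbitRep_iff h hψ h𝔭 h𝔭').2 rfl
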